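/- **Problem.** Let $T\ge 1$, $\lambda\in(0,1]$, $N_1=1$, $N_t\ge 1$. For $t=1,\dots,T$ and $i=1,\dots,N_t$ let $\bar X_t\subseteq\mathbb R^{n_t}$ be closed and convex, $H_{ti}=H_t(\cdot,\tilde c_{ti}):\mathbb R^{n_t}\to(-\infty,+\infty]$ closed and convex, $\Phi_{ti}=\Phi_t(\cdot,\tilde p_{ti})$ a finite vector of closed convex functions on $\bar X_t$, $A_{ti},B_{ti},Q_{ti}$ linear maps and $b_{ti}$ vectors. Put $$X_{ti}(x)=\{y\in\bar X_t:\ A_{ti}y=B_{ti}x+b_{ti},\ \Phi_{ti}(y)\le Q_{ti}x\}\quad(t\ge 2),\qquad X_1=\{y\in\bar X_1:\ A_{11}y=b_{11},\ \Phi_{11}(y)\le 0\}.$$ The SAA multistage problem is $F^*=\min_{x\in X_1}F_{11}(x)$, where $F_{ti}=H_{ti}+\lambda V_{t+1}$, $V_{T+1}=0$ and $V_t(x)=\frac1{N_t}\sum_{i=1}^{N_t}\min_{y\in X_{ti}(x)}F_{ti}(y)$ for $2\le t\le T$. Let $\bar{\mathcal X}_1=X_1$ and $\bar{\mathcal X}_t=\bigcup_i\bigcup_{x\in\bar{\mathcal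 X}_{t-1}}X_{ti}(x)$ be the effective feasible regions, and let $\|\cdot\|$ be the $l_\infty$ norm. **Assumptions.** $X_1\ne\emptyset$, and for every $t=1,\dots,T$: (i) $\|x-x'\|\le D_t$ for all $x,x'\in\bar{\mathcal X}_t$; (ii) there is $\bar\epsilon_t>0$ such that for all $x\in\bar{\mathcal X}_t$ and all $v$ in the linear space parallel to the affine hull of $\bar{\mathcal X}_t$ with $\|v\|\le\bar\epsilon_t$, one has $H_{ti}(x+v)<+\infty$ for all $i$, and, if $t<T$, $X_{t+1,i}(x+v)$ has nonempty relative interior for all $i$; (iii) each $F_{ti}$ is $M_t$-Lipschitz on $\bar{\mathcal X}_t$, $M_t\ge 0$. Numbers $\delta_1,\dots,\delta_T\in[0,\infty)$ are given. **Method (EDDP).** Start with $\underline V_t^0=-\infty$ for $2\le t\le T$, $\underline V_{T+1}^k=0$ for all $k\ge0$, and $S_t^0=\emptyset$. Write $\underline F_{ti}^k=H_{ti}+\lambda\underline V_{t+1}^k$, and let $g_t^k(x)=\min_{s\in S_t^{k-1}}\|s-x\|$ for $t<T$ ($+\infty$ if $S_t^{k-1}=\emptyset$), $g_T^k=0$.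 Iteration $k=1,2,\dots$: *Forward phase.* For $t=1,\dots,T$: for each $i$ take $\tilde x_{ti}^k$ minimizing $\underline F_{ti}^{k-1}$ over $X_{ti}(x_{t-1}^k)$ (over $X_1$ if $t=1$); let $x_t^k$ be one of the $\tilde x_{ti}^k$ with the largest $g_t^k(\tilde x_{ti}^k)$. If $g_1^k(x_1^k)\le\delta_1$, stop. *Backward phase.* For $t=T,\dots,2$: set $S_{t-1}^k=S_{t-1}^{k-1}\cup\{x_{t-1}^k\}$ if $g_t^k(x_t^k)\le\delta_t$ and $S_{t-1}^k=S_{t-1}^{k-1}$ otherwise; for each $i$ let $\tilde\nu_{ti}^k$ be the minimum of $\underline F_{ti}^k$ over $X_{ti}(x_{t-1}^k)$, let $(y_{ti},z_{ti})$, $z_{ti}\ge 0$, be optimal Lagrange multipliers of its constraints $A_{ti}u=B_{ti}x_{t-1}^k+b_{ti}$ and $\Phi_{ti}(u)\le Q_{ti}x_{t-1}^k$ (the infimum over $u\in\bar X_t$ of $\underline F_{ti}^k(u)+\langle y_{ti},B_{ti}x_{t-1}^k+b_{ti}-A_{ti}u\rangle+\langle z_{ti},\Phi_{ti}(u)-Q_{ti}x_{t-1}^k\rangle$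 is $\tilde\nu_{ti}^k$); and set $$\underline V_t^k(x)=\max\Big\{\underline V_t^{k-1}(x),\ \tfrac1{N_t}\sum_i\big[\tilde\nu_{ti}^k+\langle B_{ti}^{\top}y_{ti}-Q_{ti}^{\top}z_{ti},\,x-x_{t-1}^k\rangle\big]\Big\}.$$ All choices (minimizers, ties, multipliers) are arbitrary. **Theorem.** For every execution of the method there are constants $\underline M_t\ge 0$ such that all the models $\underline F_{ti}^k$, $k\ge1$, built in its iterations performed so far are $\underline M_t$-Lipschitz on $\bar{\mathcal X}_t$. For any such constants let $$\epsilon_0=\sum_{\tau=0}^{T-2}(M_{\tau+1}+\underline M_{\tau+1})\,\delta_{\tau+1}\,\lambda^{\tau},\qquad \bar K=\sum_{t=1}^{T-1}\Big(\frac{D_t}{\delta_t}+1\Big)^{n_t}\in[0,+\infty]$$ (with $D_t/0=+\infty$ for $D_t>0$, $0/0=0$, and $(+\infty)^0=1$). Then every execution that has not stopped has performed at most $\bar K$ iterations, so at most $\bar K+1$ iterations are performed; and if the method stops in iteration $k$, then $F^*$ is finite, $x_1^k\in X_1$ and $$F_{11}(x_1^k)-F^*\le\epsilon_0 .$$ In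 particular, if $n_t\le n$, $D_t\le D$, $\max\{M_t,\underline M_t\}\le M$ and $\delta_t=\epsilon$ for all $t=1,\dots,T$, then the same holds with $\bar K$ replaced by $(T-1)\left(\frac D\epsilon+1\right)^n$ and with $$F_{11}(x_1^k)-F^*\le 2M\min\Big\{\frac1{1-\lambda},\,T-1\Big\}\,\epsilon ,$$ where $\frac1{1-\lambda}=+\infty$ if $\lambda=1$. These iteration bounds do not depend on the $N_t$. Moreover, if Slater's condition holds for the subproblems of the stages $2,\dots,T$ (for all $1\le t<T$, $x\in\bar{\mathcal X}_t$ and $i$ there is $u$ in the relative interior of $\bar X_{t+1}\cap\{H_{t+1,i}<+\infty\}$ with $A_{t+1,i}u=B_{t+1,i}x+b_{t+1,i}$ and $\Phi_{t+1,i}(u)<Q_{t+1,i}x$ componentwise), then every execution that has not stopped can be continued by a further iteration; hence, if $\bar K<\infty$, the method stops after at most $\bar K+1$ iterations. -/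

import Mathlib

open scoped ENNReal

noncomputable section

/-- `ℝ^d`, with the `l_∞` norm (the norm that Mathlib puts on `Fin d → ℝ`). -/
abbrev Vec (d : ℕ) : Type := Fin d → ℝ

/-- A closed convex function with values in `(-∞, +∞]`: its epigraph is closed and convex. -/
def IsClosedConvexFun {d : ℕ} (f : Vec d → EReal) : Prop :=
  (∀ x, f x ≠ ⊥) ∧
  Convex ℝ {q : Vec d × ℝ | f q.1 ≤ (q.2 : EReal)} ∧
  IsClosed {q : Vec d × ℝ | f q.1 ≤ (q.2 : EReal)}

/-- `S` together with its neighbourhood of radius `r` inside its affine hull: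
the displacements are taken in the linear space parallel to the affine hull. -/
def affNhd {d : ℕ} (S : Set (Vec d)) (r : ℝ) : Set (Vec d) :=
  {z | ∃ x ∈ S, ∃ v ∈ (affineSpan ℝ S).direction, ‖v‖ ≤ r ∧ z = x + v}

/-- The data of a `T`-stage sample average approximation problem. The stages are `1, …, T`; the
data at other indices are never used. Stage `t` has `N t` samples, the first stage has one.
`H t i` is the cost `H_t(·, c_{ti})` and `Phi t i j` is the `j`-th component of `Φ_t(·, p_{ti})`.
The matrices that act on the previous decision `x_t` at stage `t + 1` are `B t i` and `Q t i`
(that is, `B_{t+1,i}` and `Q_{t+1,i}`). -/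
structure SAAProblem where
  T : ℕ
  one_le_T : 1 ≤ T
  lam : ℝ
  lam_pos : 0 < lam
  lam_le_one : lam ≤ 1
  n : ℕ → ℕ
  m : ℕ → ℕ
  p : ℕ → ℕ
  N : ℕ → ℕ
  N_pos : ∀ t, 0 < N t
  N_one : N 1 = 1
  Xbar : ∀ t, Set (Vec (n t))
  Xbar_closed : ∀ t, IsClosed (Xbar t)
  Xbar_convex : ∀ t, Convex ℝ (Xbar t)
  H : ∀ t, Fin (N t) → Vec (n t) → EReal
  H_closedConvex : ∀ t i, IsClosedConvexFun (H t i)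
  A : ∀ t, Fin (N t) → Vec (n t) →ₗ[ℝ] Vec (m t)
  b : ∀ t, Fin (N t) → Vec (m t)
  Phi : ∀ t, Fin (N t) → Fin (p t) → Vec (n t) → ℝ
  Phi_convex : ∀ t i j, ConvexOn ℝ (Xbar t) (Phi t i j)
  Phi_closed : ∀ t i j, LowerSemicontinuousOn (Phi t i j) (Xbar t)
  B : ∀ t, Fin (N (t + 1)) → Vec (n t) →ₗ[ℝ] Vec (m (t + 1))
  Q : ∀ t, Fin (N (t + 1)) → Vec (n t) →ₗ[ℝ] Vec (p (t + 1))

namespace SAAProblem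

variable (P : SAAProblem)

/-- The feasible set `X_{t+1}(x, ξ_{t+1,i})` for `x ∈ ℝ^{n_t}`. The first-stage feasible set `X_1`
is `feas 0 i 0`: at `x = 0` its constraints read `A_1 y = b_1`, `Φ_1(y) ≤ 0`. -/
def feas (t : ℕ) (i : Fin (P.N (t + 1))) (x : Vec (P.n t)) : Set (Vec (P.n (t + 1))) :=
  {y | y ∈ P.Xbar (t + 1) ∧ P.A (t + 1) i y = P.B t i x + P.b (t + 1) i ∧
    ∀ j, P.Phi (t + 1) i j y ≤ P.Q t i x j}

/-- The only scenario of the first stage. -/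
def firstScenario : Fin (P.N (0 + 1)) := ⟨0, P.N_pos 1⟩

/-- The first-stage feasible set `X_1`. -/
def X1 : Set (Vec (P.n 1)) := P.feas 0 P.firstScenario 0

/-- The effective feasible region of stage `t`: it is `X_1` for `t = 1`, and
`⋃_i ⋃_{x ∈ region t} X_{t+1}(x, ξ_{t+1,i})` at stage `t + 1`. -/
def region : ∀ t, Set (Vec (P.n t))
  | 0 => {0}
  | t + 1 => ⋃ i, ⋃ x ∈ region t, P.feas t i x

/-- Expected optimal cost of the next `r` stages when the decision of stage `t` is `x`. -/
def costToGo : ℕ → ∀ t, Vec (P.n t) → EReal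
  | 0, _, _ => 0
  | r + 1, t, x =>
    (((P.N (t + 1) : ℝ)⁻¹ : ℝ) : EReal) *
      ∑ i, ⨅ y ∈ P.feas t i x, (P.H (t + 1) i y + (P.lam : EReal) * costToGo r (t + 1) y)

/-- The value function `V_{t+1}` on `ℝ^{n_t}`; `V_{T+1} = 0`. -/
def V (t : ℕ) (x : Vec (P.n t)) : EReal := P.costToGo (P.T - t) t x

/-- `F_{ti}(x) = H_t(x, c_{ti}) + λ V_{t+1}(x)`. -/
def F (t : ℕ) (i : Fin (P.N t)) (x : Vec (P.n t)) : EReal :=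
  P.H t i x + (P.lam : EReal) * P.V t x

/-- The optimal value `F^*`. -/
def Fstar : EReal := ⨅ y ∈ P.X1, P.F 1 P.firstScenario y

/-- `x` is feasible for the first stage and `F_{11}(x) - F^* ≤ e`, where `F^*` is finite. -/
def IsApproxSol (x : Vec (P.n 1)) (e : ℝ) : Prop :=
  x ∈ P.X1 ∧ P.Fstar ≠ ⊥ ∧ P.Fstar ≠ ⊤ ∧ P.F 1 P.firstScenario x ≤ P.Fstar + (e : EReal)

/-! ### Assumptions -/

/-- `D_t` bounds the `l_∞` diameter of the effective feasible region of stage `t`. -/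
def DiameterBound (D : ℕ → ℝ) : Prop :=
  ∀ t, 1 ≤ t → t ≤ P.T → 0 ≤ D t ∧ ∀ x ∈ P.region t, ∀ x' ∈ P.region t, ‖x - x'‖ ≤ D t

/-- The problem is feasible at the first stage, and around the effective feasible region of each
stage the costs are finite and the sets `X_{t+1}(x, ξ_{t+1,i})` have nonempty relative interior. -/
def Regular : Prop :=
  P.X1.Nonempty ∧
  ∀ t, 1 ≤ t → t ≤ P.T → ∃ r : ℝ, 0 < r ∧ ∀ x ∈ affNhd (P.region t) r,
    (∀ i, P.H t i x < ⊤) ∧ (t < P.T → ∀ i, (intrinsicInterior ℝ (P.feas t i x)).Nonempty)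

/-- The functions `F_{ti}` are `M_t`-Lipschitz on the effective feasible region of stage `t`. -/
def LipschitzBound (M : ℕ → ℝ) : Prop :=
  ∀ t, 1 ≤ t → t ≤ P.T → 0 ≤ M t ∧ ∀ i, ∀ x ∈ P.region t, ∀ x' ∈ P.region t,
    P.F t i x ≤ P.F t i x' + ((M t * ‖x - x'‖ : ℝ) : EReal)

/-- Slater's condition for the subproblems of the stages `2, …, T`. -/
def Slater : Prop :=
  ∀ t, 1 ≤ t → t < P.T → ∀ x ∈ P.region t, ∀ i,
    ∃ u ∈ intrinsicInterior ℝ (P.Xbar (t + 1) ∩ {u | P.H (t + 1) i u < ⊤}),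
      P.A (t + 1) i u = P.B t i x + P.b (t + 1) i ∧ ∀ j, P.Phi (t + 1) i j u < P.Q t i x j

/-! ### The explorative dual dynamic programming method -/

/-- What is carried from one iteration to the next: `model t` is the cutting plane model of
`V_{t+1}` on `ℝ^{n_t}`, and `sat t` is the set `S_t` of saturated search points of stage `t`. -/
structure State where
  model : ∀ t, Vec (P.n t) → EReal
  sat : ∀ t, Set (Vec (P.n t))

/-- The points computed by a forward phase: the candidates `cand t i` (one for each
subproblem of stage `t`) and the chosen search points `x t`. -/
structure ForwardPass where
  cand : ∀ t, Fin (P.N t) → Vec (P.n t)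
  x : ∀ t, Vec (P.n t)

/-- The models are `-∞` for `V_2, …, V_T` and `0` for `V_{T+1}`, and no point is saturated. -/
def initState : P.State where
  model := fun t _ => if t < P.T then ⊥ else 0
  sat := fun _ => ∅

variable {P}

/-- The model `H_t(x, c_{ti}) + λ (model of V_{t+1})(x)` of `F_{ti}`. -/
def State.Flow (s : P.State) (t : ℕ) (i : Fin (P.N t)) (x : Vec (P.n t)) : EReal :=
  P.H t i x + (P.lam : EReal) * s.model t x

/-- For `t < T` the `l_∞` distance from `x` to the set of saturated points of stage `t` (`+∞` if
there are none), and `0` for `t = T`. -/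
def State.gap (s : P.State) (t : ℕ) (x : Vec (P.n t)) : ℝ≥0∞ :=
  if t < P.T then Metric.infEDist x (s.sat t) else 0

/-- `w` is a possible outcome of the forward phase started from `s`: for each stage, each candidate
minimizes its model subproblem, and the chosen point is a most distinguishable candidate. -/
def IsForward (s : P.State) (w : P.ForwardPass) : Prop :=
  w.x 0 = 0 ∧ ∀ t, t < P.T →
    (∀ i, w.cand (t + 1) i ∈ P.feas t i (w.x t) ∧
      ∀ y ∈ P.feas t i (w.x t), s.Flow (t + 1) i (w.cand (t + 1) i) ≤ s.Flow (t + 1) i y) ∧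
    ∃ i, w.x (t + 1) = w.cand (t + 1) i ∧
      ∀ j, s.gap (t + 1) (w.cand (t + 1) j) ≤ s.gap (t + 1) (w.x (t + 1))

/-- `v` is the optimal value of `min {f(u) : u ∈ X_{t+1}(x, ξ_{t+1,i})}` and `(y, z)` are optimal
Lagrange multipliers for its constraints `A u = B x + b` and `Φ(u) ≤ Q x`: `z ≥ 0` and the infimum
over `u ∈ Xbar (t + 1)` of the Lagrangian
`f(u) + ⟨y, B x + b - A u⟩ + ⟨z, Φ(u) - Q x⟩` is `v`. -/
def IsValueWithMultipliers (t : ℕ) (i : Fin (P.N (t + 1))) (x : Vec (P.n t))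
    (f : Vec (P.n (t + 1)) → EReal) (v : ℝ) (y : Vec (P.m (t + 1))) (z : Vec (P.p (t + 1))) :
    Prop :=
  (⨅ u ∈ P.feas t i x, f u) = (v : EReal) ∧
  (∀ j, 0 ≤ z j) ∧
  (⨅ u ∈ P.Xbar (t + 1), (f u +
      (((∑ j, y j * (P.B t i x j + P.b (t + 1) i j - P.A (t + 1) i u j)) +
        ∑ j, z j * (P.Phi (t + 1) i j u - P.Q t i x j) : ℝ) : EReal))) = (v : EReal)

/-- The affine function `e ↦ v + ⟨Bᵀ y - Qᵀ z, e - x⟩` of `ℝ^{n_t}`. -/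
def cut (t : ℕ) (i : Fin (P.N (t + 1))) (x : Vec (P.n t))
    (v : ℝ) (y : Vec (P.m (t + 1))) (z : Vec (P.p (t + 1))) (e : Vec (P.n t)) : ℝ :=
  v + (∑ j, y j * P.B t i (e - x) j) - ∑ j, z j * P.Q t i (e - x) j

/-- `s'` is a possible outcome of the backward phase started from `s` after the forward phase `w`.
The cut added to the model of `V_{t+1}` comes from the subproblems of stage `t + 1` at `w.x t`,
solved with the new model of `V_{t+2}`. The point `w.x t` is added to the saturated points of
stage `t` when the point of stage `t + 1` is within `δ_{t+1}` of the previous saturated points. -/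
def IsBackward (δ : ℕ → ℝ) (s : P.State) (w : P.ForwardPass) (s' : P.State) : Prop :=
  s'.model P.T = s.model P.T ∧
  ∀ t, 1 ≤ t → t < P.T →
    (∃ (v : Fin (P.N (t + 1)) → ℝ) (y : Fin (P.N (t + 1)) → Vec (P.m (t + 1)))
        (z : Fin (P.N (t + 1)) → Vec (P.p (t + 1))),
      (∀ i, IsValueWithMultipliers t i (w.x t) (s'.Flow (t + 1) i) (v i) (y i) (z i)) ∧
      ∀ e, s'.model t e = max (s.model t e)
        (((P.N (t + 1) : ℝ)⁻¹ * ∑ i, cut t i (w.x t) (v i) (y i) (z i) e : ℝ) : EReal)) ∧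
    (s.gap (t + 1) (w.x (t + 1)) ≤ ENNReal.ofReal (δ (t + 1)) →
      s'.sat t = insert (w.x t) (s.sat t)) ∧
    (¬ s.gap (t + 1) (w.x (t + 1)) ≤ ENNReal.ofReal (δ (t + 1)) → s'.sat t = s.sat t)

/-- The termination test, made after the forward phase. -/
def Stops (δ : ℕ → ℝ) (s : P.State) (w : P.ForwardPass) : Prop :=
  s.gap 1 (w.x 1) ≤ ENNReal.ofReal (δ 1)

variable (P)

/-- An execution of `K` iterations: iteration `k + 1` leads from `s k` to `s (k + 1)` with forward
phase `w (k + 1)`; the backward phase takes place when the termination test fails, and no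
iteration follows one in which the test succeeds. -/
def IsExecution (δ : ℕ → ℝ) (K : ℕ) (s : ℕ → P.State) (w : ℕ → P.ForwardPass) : Prop :=
  s 0 = P.initState ∧
  (∀ k, k < K → IsForward (s k) (w (k + 1)) ∧
    (Stops δ (s k) (w (k + 1)) → s (k + 1) = s k) ∧
    (¬ Stops δ (s k) (w (k + 1)) → IsBackward δ (s k) (w (k + 1)) (s (k + 1)))) ∧
  ∀ k, k + 1 < K → ¬ Stops δ (s k) (w (k + 1))

/-- The termination test succeeds in iteration `K`. -/
def StoppedAt (δ : ℕ → ℝ) (K : ℕ) (s : ℕ → P.State) (w : ℕ → P.ForwardPass) : Prop :=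
  ∃ k, K = k + 1 ∧ Stops δ (s k) (w (k + 1))

/-- The models of `F_{ti}` that are built in the iterations `1, …, K` are `Mlow t`-Lipschitz on
the effective feasible region of stage `t`. -/
def ModelLipschitzBound (K : ℕ) (s : ℕ → P.State) (Mlow : ℕ → ℝ) : Prop :=
  ∀ t, 1 ≤ t → t ≤ P.T → 0 ≤ Mlow t ∧
    ∀ k, 1 ≤ k → k ≤ K → ∀ i, ∀ x ∈ P.region t, ∀ x' ∈ P.region t,
      (s k).Flow t i x ≤ (s k).Flow t i x' + ((Mlow t * ‖x - x'‖ : ℝ) : EReal)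

/-! ### The bounds -/

/-- `ε_t = ∑_{τ=t}^{T-2} (M_{τ+1} + Mlow_{τ+1}) δ_{τ+1} λ^{τ-t}`. -/
def eps (M Mlow δ : ℕ → ℝ) (t : ℕ) : ℝ :=
  ∑ τ ∈ Finset.Ico t (P.T - 1), (M (τ + 1) + Mlow (τ + 1)) * δ (τ + 1) * P.lam ^ (τ - t)

/-- `∑_{t=1}^{T-1} (D_t / δ_t + 1)^{n_t}`, in `[0, +∞]` since `δ_t = 0` is allowed. -/
def iterBound (D δ : ℕ → ℝ) : ℝ≥0∞ :=
  ∑ t ∈ Finset.Ico 1 P.T, (ENNReal.ofReal (D t) / ENNReal.ofReal (δ t) + 1) ^ P.n t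

/-- `(T - 1) (D / ε + 1)^n`. -/
def uniformIterBound (n : ℕ) (D ε : ℝ) : ℝ≥0∞ :=
  ((P.T - 1 : ℕ) : ℝ≥0∞) * (ENNReal.ofReal D / ENNReal.ofReal ε + 1) ^ n

/-- `min {1 / (1 - λ), T - 1}`, where `1 / (1 - λ)` is `+∞` for `λ = 1`. -/
def horizonFactor : ℝ :=
  if P.lam < 1 then min (1 / (1 - P.lam)) ((P.T : ℝ) - 1) else (P.T : ℝ) - 1

end SAAProblem

end

/-! ### Separated sets in the `l_∞` norm -/

/-! Accuracy. By weak duality every cut lies below the value function (`cut_le`,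
`IsBackward.model_le_V`), and the models never decrease. The key invariant (`sat_spec`) is that at a
saturated point of stage `t` the model error is at most `eps t`. It propagates as follows. A
candidate of stage `t + 1` within `δ_{t+1}` of a saturated point inherits that point's error, up to
the Lipschitz constants of `F` and of its model (`F_le_Flow_of_gap_le`); this is the recursion `eps
t = (M + Mlow) δ + λ eps (t + 1)`, with constants and `δ` taken at `t + 1`. The forward point has
the largest gap, so if it passes the test, all candidates do, whatever their number. Averaging over
the scenarios bounds the error of the new cut at the current point of stage `t`, which is therefore
rightly declared saturated. At termination the same transfer at stage 1, where the candidate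
minimizes a lower model, gives the accuracy (`isApproxSol`).

Iteration count. If the test fails, the gap exceeds `δ` at stage 1, while it is `0` at stage `T`. So
some `x_t` is far from the saturated points although `x_{t+1}` is near, and `x_t` becomes a new
saturated point far from all old ones. Each such iteration thus enlarges a `δ_t`-separated subset of
some region (`exists_separated`), whose size a grid argument bounds (`card_le_of_separated`).

The remaining claims are convex analysis. Model Lipschitz constants exist because a convex function
finite around a bounded set is Lipschitz on it, and after the first backward phase the models are
finite maxima of affine functions. A further iteration exists because feasible sets are compact and
Slater's condition yields multipliers (`exists_lagrange_multipliers`). -/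

theorem card_le_of_separated_of_pos {n : ℕ} {D δ : ℝ} (hδ : 0 < δ) (R : Finset (Vec n))
    (hD : ∀ x ∈ R, ∀ y ∈ R, ‖x - y‖ ≤ D) (hsep : ∀ x ∈ R, ∀ y ∈ R, x ≠ y → δ < ‖x - y‖) :
    R.card ≤ (⌊D / δ⌋₊ + 1) ^ n := by
  classical
  rcases R.eq_empty_or_nonempty with rfl | hne
  · simp
  -- Measured from the coordinatewise minimum, all coordinates lie in `[0, D]`, which is cut into
  -- `⌊D / δ⌋ + 1` cells of width `δ`. Two points in the same cell are at distance at most `δ`,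
  -- which the strict separation forbids.
  have hmin : ∀ j, ∃ a ∈ R, ∀ x ∈ R, a j ≤ x j := fun j => R.exists_min_image (fun x => x j) hne
  choose a haR ha using hmin
  have hmaps : ∀ x ∈ R, (fun j => ⌊(x j - a j j) / δ⌋₊) ∈
      Fintype.piFinset fun _ : Fin n => Finset.range (⌊D / δ⌋₊ + 1) := by
    intro x hx
    rw [Fintype.mem_piFinset]
    intro j
    rw [Finset.mem_range, Nat.lt_succ_iff]
    refine Nat.floor_le_floor (div_le_div_of_nonneg_right ?_ hδ.le)
    have h := (norm_le_pi_norm (x - a j) j).trans (hD x hx _ (haR j))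
    exact (le_abs_self _).trans h
  have hinj : Set.InjOn (fun x : Vec n => fun j => ⌊(x j - a j j) / δ⌋₊) R := by
    intro x hx y hy hxy
    by_contra hne
    refine absurd (hsep x hx y hy hne) (not_lt.2 ((pi_norm_le_iff_of_nonneg hδ.le).2 fun j => ?_))
    have hj : ⌊(x j - a j j) / δ⌋₊ = ⌊(y j - a j j) / δ⌋₊ := congrFun hxy j
    have hx0 : 0 ≤ (x j - a j j) / δ := div_nonneg (sub_nonneg.2 (ha j x hx)) hδ.le
    have hy0 : 0 ≤ (y j - a j j) / δ := div_nonneg (sub_nonneg.2 (ha j y hy)) hδ.le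
    have h1 := Nat.floor_le hx0
    have h2 := Nat.lt_floor_add_one ((x j - a j j) / δ)
    have h3 := Nat.floor_le hy0
    have h4 := Nat.lt_floor_add_one ((y j - a j j) / δ)
    rw [hj] at h1 h2
    have h5 : |(x j - a j j) / δ - (y j - a j j) / δ| ≤ 1 := by
      rw [abs_le]; constructor <;> linarith
    rw [← sub_div, abs_div, abs_of_pos hδ, div_le_one hδ] at h5
    simpa using h5
  have := Finset.card_le_card_of_injOn _ hmaps hinj
  simpa using this

theorem card_le_of_separated {n : ℕ} {D δ : ℝ} (hδ : 0 ≤ δ) (hD0 : 0 ≤ D) (R : Finset (Vec n))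
    (hD : ∀ x ∈ R, ∀ y ∈ R, ‖x - y‖ ≤ D) (hsep : ∀ x ∈ R, ∀ y ∈ R, x ≠ y → δ < ‖x - y‖) :
    (R.card : ℝ≥0∞) ≤ (ENNReal.ofReal D / ENNReal.ofReal δ + 1) ^ n := by
  have one_case : R.card ≤ 1 → (R.card : ℝ≥0∞) ≤ (ENNReal.ofReal D / ENNReal.ofReal δ + 1) ^ n :=
    fun h => (by exact_mod_cast h : (R.card : ℝ≥0∞) ≤ 1).trans (one_le_pow₀ le_add_self)
  rcases hδ.lt_or_eq with hδ | rfl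
  · have h : (R.card : ℝ≥0∞) ≤ ((⌊D / δ⌋₊ : ℝ≥0∞) + 1) ^ n := by
      exact_mod_cast card_le_of_separated_of_pos hδ R hD hsep
    refine h.trans ?_
    gcongr
    rw [← ENNReal.ofReal_div_of_pos hδ, ← ENNReal.ofReal_natCast]
    exact ENNReal.ofReal_le_ofReal (Nat.floor_le (div_nonneg hD0 hδ.le))
  -- For `δ = 0` the conventions of `ℝ≥0∞` matter: the base is `⊤` if `D > 0`, with `⊤ ^ 0 = 1`
  -- covering the one-point space, and `0 / 0 + 1 = 1` if `D = 0`, where all points coincide.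
  · rcases hD0.lt_or_eq with hD0 | rfl
    · rcases Nat.eq_zero_or_pos n with rfl | hn
      · exact one_case (Finset.card_le_one.2 fun x _ y _ => Subsingleton.elim x y)
      · rw [ENNReal.ofReal_zero, ENNReal.div_zero (by simpa using hD0), top_add,
          ENNReal.top_pow hn.ne']
        exact le_top
    · refine one_case (Finset.card_le_one.2 fun x hx y hy => ?_)
      exact sub_eq_zero.1 (norm_le_zero_iff.1 (hD x hx y hy))

/-! ### Closed convex functions with values in `(-∞, +∞]` -/

namespace IsClosedConvexFun

variable {d : ℕ} {f : Vec d → EReal}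

theorem coe_toReal (hf : IsClosedConvexFun f) {x : Vec d} (hx : f x < ⊤) :
    ((f x).toReal : EReal) = f x :=
  EReal.coe_toReal hx.ne (hf.1 x)

theorem le_combo (hf : IsClosedConvexFun f) {x y : Vec d} (hx : f x < ⊤) (hy : f y < ⊤)
    {a b : ℝ} (ha : 0 ≤ a) (hb : 0 ≤ b) (hab : a + b = 1) :
    f (a • x + b • y) ≤ ((a * (f x).toReal + b * (f y).toReal : ℝ) : EReal) := by
  have h := hf.2.1 (x := (x, (f x).toReal)) (y := (y, (f y).toReal))
    (by simp [hf.coe_toReal hx]) (by simp [hf.coe_toReal hy]) ha hb hab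
  simpa using h

theorem convex_dom (hf : IsClosedConvexFun f) : Convex ℝ {x | f x < ⊤} :=
  fun _ hx _ hy _ _ ha hb hab => (hf.le_combo hx hy ha hb hab).trans_lt (EReal.coe_lt_top _)

theorem convexOn_toReal (hf : IsClosedConvexFun f) :
    ConvexOn ℝ {x | f x < ⊤} fun x => (f x).toReal := by
  refine ⟨hf.convex_dom, fun x hx y hy a b ha hb hab => ?_⟩
  have h := hf.le_combo hx hy ha hb hab
  rw [← hf.coe_toReal (hf.convex_dom hx hy ha hb hab)] at h
  simpa using EReal.coe_le_coe_iff.1 h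

theorem lowerSemicontinuous (hf : IsClosedConvexFun f) : LowerSemicontinuous f := by
  rw [lowerSemicontinuous_iff_isClosed_preimage]
  intro c
  induction c using EReal.rec with
  | bot =>
    have : f ⁻¹' Set.Iic ⊥ = ∅ := by ext x; simp [hf.1 x]
    rw [this]; exact isClosed_empty
  | coe r => exact hf.2.2.preimage (Continuous.prodMk_left r)
  | top => simp

/-- A closed convex function that is finite around a bounded set is Lipschitz on this set. -/
theorem exists_lipschitz (hf : IsClosedConvexFun f) {S : Set (Vec d)} {r D : ℝ} (hr : 0 < r)
    (hS : ∀ x ∈ S, ∀ y ∈ S, ‖x - y‖ ≤ D) (hfin : ∀ x ∈ affNhd S r, f x < ⊤) :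
    ∃ L : ℝ, 0 ≤ L ∧ ∀ x ∈ S, ∀ y ∈ S, f x ≤ f y + ((L * ‖x - y‖ : ℝ) : EReal) := by
  rcases S.eq_empty_or_nonempty with rfl | ⟨x₀, hx₀⟩
  · exact ⟨0, le_rfl, by simp⟩
  set E := (affineSpan ℝ S).direction with hE
  have hsub : ∀ x ∈ S, ∀ y ∈ S, x - y ∈ E := fun x hx y hy =>
    AffineSubspace.vsub_mem_direction (mem_affineSpan ℝ hx) (mem_affineSpan ℝ hy)
  -- After translation to the direction space `E` of the affine hull, the relative neighbourhood
  -- becomes a genuine one. The compact closure of `S₀` then lies in the interior of the domain,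
  -- where a convex function is locally Lipschitz.
  let U : Set E := {v | f (x₀ + v) < ⊤}
  let g : E → ℝ := fun v => (f (x₀ + v)).toReal
  have hg : ConvexOn ℝ U g := by
    have hcombo : ∀ (v w : E) (a b : ℝ), a + b = 1 →
        x₀ + ((a • v + b • w : E) : Vec d) = a • (x₀ + (v : Vec d)) + b • (x₀ + (w : Vec d)) := by
      intro v w a b hab
      have : x₀ = a • x₀ + b • x₀ := by rw [← add_smul, hab, one_smul]
      conv_lhs => rw [this]
      simp only [Submodule.coe_add, Submodule.coe_smul, smul_add]
      abel
    refine ⟨fun v hv w hw a b ha hb hab => ?_, fun v hv w hw a b ha hb hab => ?_⟩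
    · change f _ < ⊤
      rw [hcombo v w a b hab]
      exact hf.convex_dom hv hw ha hb hab
    · change (f _).toReal ≤ _
      rw [hcombo v w a b hab]
      exact hf.convexOn_toReal.2 hv hw ha hb hab
  let S₀ : Set E := {v | x₀ + (v : Vec d) ∈ S}
  have hthick : Metric.thickening r S₀ ⊆ U := by
    intro v hv
    obtain ⟨s, hs, hvs⟩ := Metric.mem_thickening_iff.1 hv
    refine hfin _ ⟨x₀ + s, hs, (v - s : E), (v - s : E).2, ?_, ?_⟩
    · rw [dist_eq_norm] at hvs
      exact hvs.le
    · simp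
  have hbdd : Bornology.IsBounded S₀ := by
    refine isBounded_iff_forall_norm_le.2 ⟨D, fun v hv => ?_⟩
    simpa using hS _ hv _ hx₀
  have hcomp : IsCompact (closure S₀) := hbdd.isCompact_closure
  have hsubset : closure S₀ ⊆ interior U :=
    (Metric.closure_subset_thickening hr S₀).trans
      (interior_maximal hthick Metric.isOpen_thickening)
  obtain ⟨K, hK⟩ := (hg.locallyLipschitzOn_interior.mono hsubset).exists_lipschitzOnWith_of_compact
    hcomp
  have hmem : ∀ x ∈ S, f x < ⊤ := fun x hx =>
    hfin x ⟨x, hx, 0, Submodule.zero_mem _, by simpa using hr.le, by simp⟩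
  refine ⟨K, K.2, fun x hx y hy => ?_⟩
  let vx : E := ⟨x - x₀, hsub x hx x₀ hx₀⟩
  let vy : E := ⟨y - x₀, hsub y hy x₀ hx₀⟩
  have hvx : x₀ + (vx : Vec d) = x := by simp [vx]
  have hvy : x₀ + (vy : Vec d) = y := by simp [vy]
  have h := hK.dist_le_mul vx (subset_closure (by simpa [S₀, hvx] using hx)) vy
    (subset_closure (by simpa [S₀, hvy] using hy))
  have hd : dist vx vy = ‖x - y‖ := by
    rw [dist_eq_norm]
    change ‖((vx - vy : E) : Vec d)‖ = _
    simp [vx, vy]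
  rw [hd, Real.dist_eq] at h
  simp only [g, hvx, hvy] at h
  rw [← hf.coe_toReal (hmem x hx), ← hf.coe_toReal (hmem y hy), ← EReal.coe_add,
    EReal.coe_le_coe_iff]
  linarith [le_abs_self ((f x).toReal - (f y).toReal)]

end IsClosedConvexFun

/-! ### Lagrange multipliers -/

theorem exists_pos_smul_mem_of_mem_intrinsicInterior {d : ℕ} {C : Set (Vec d)} {u₀ l : Vec d}
    (hu₀ : u₀ ∈ intrinsicInterior ℝ C) (hl : l ∈ (affineSpan ℝ C).direction) :
    ∃ ε : ℝ, 0 < ε ∧ u₀ + ε • l ∈ C := by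
  obtain ⟨w, hw, rfl⟩ := mem_intrinsicInterior.1 hu₀
  obtain ⟨r, hr, hball⟩ := Metric.isOpen_iff.1 isOpen_interior w hw
  have hmem : ∀ ε : ℝ, (w : Vec d) + ε • l ∈ affineSpan ℝ C := fun ε => by
    rw [add_comm]
    exact AffineSubspace.vadd_mem_of_mem_direction (Submodule.smul_mem _ ε hl) w.2
  have hpos : 0 < r / (‖l‖ + 1) := by positivity
  refine ⟨r / (‖l‖ + 1), hpos, ?_⟩
  have : (⟨_, hmem (r / (‖l‖ + 1))⟩ : affineSpan ℝ C) ∈ Metric.ball w r := by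
    rw [Metric.mem_ball, Subtype.dist_eq, dist_eq_norm]
    simp only [add_sub_cancel_left]
    rw [norm_smul, Real.norm_of_nonneg hpos.le, div_mul_eq_mul_div, div_lt_iff₀ (by positivity)]
    nlinarith [norm_nonneg l]
  exact (interior_subset (hball this) : (⟨_, hmem (r / (‖l‖ + 1))⟩ : affineSpan ℝ C) ∈ _)

/-- Strong Lagrange duality for a convex program with affine equality constraints and convex
inequality constraints, under Slater's condition. -/
theorem exists_lagrange_multipliers {d m p : ℕ} {C : Set (Vec d)} {f : Vec d → ℝ}
    (hf : ConvexOn ℝ C f) (A : Vec d →ₗ[ℝ] Vec m) (a : Vec m) {φ : Fin p → Vec d → ℝ}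
    (hφ : ∀ j, ConvexOn ℝ C (φ j)) (q : Vec p) {u₀ : Vec d} (hu₀ : u₀ ∈ intrinsicInterior ℝ C)
    (hA : A u₀ = a) (hq : ∀ j, φ j u₀ < q j) {v : ℝ}
    (hv : ∀ u ∈ C, A u = a → (∀ j, φ j u ≤ q j) → v ≤ f u) :
    ∃ (y : Vec m) (z : Vec p), (∀ j, 0 ≤ z j) ∧
      ∀ u ∈ C, v ≤ f u + ((∑ j, y j * (a j - A u j)) + ∑ j, z j * (φ j u - q j)) := by
  classical
  have hu₀C : u₀ ∈ C := intrinsicInterior_subset hu₀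
  let L := (affineSpan ℝ C).direction
  -- The residuals are kept in the image of the direction space rather than in all of `Vec m`: `A`
  -- need not be surjective, and the covering property `hdense` would fail in the larger space.
  let E := L.map A
  have hAE : ∀ u ∈ C, A u - a ∈ E := fun u hu => by
    rw [← hA, ← map_sub]
    exact Submodule.mem_map_of_mem (AffineSubspace.vsub_mem_direction (mem_affineSpan ℝ hu)
      (mem_affineSpan ℝ hu₀C))
  -- Cone of scaled residuals and cost excesses over `v`, closed upwards in the last two components.
  -- A functional that is nonnegative on it and is the identity on the cost axis is a pair of
  -- multipliers. Prescribing that value and using the Riesz extension theorem makes the cost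
  -- coefficient equal to `1` from the start, so no normalization is needed.
  let S : PointedCone ℝ (E × Vec p × ℝ) :=
    { carrier := {w | ∃ t : ℝ, 0 ≤ t ∧ ∃ u ∈ C, (w.1 : Vec m) = t • (A u - a) ∧
        (∀ j, t * (φ j u - q j) ≤ w.2.1 j) ∧ t * (f u - v) ≤ w.2.2}
      zero_mem' := ⟨0, le_rfl, u₀, hu₀C, by simp, by simp, by simp⟩
      smul_mem' := by
        rintro c w ⟨t, ht, u, hu, h1, h2, h3⟩
        refine ⟨c * t, mul_nonneg c.2 ht, u, hu, ?_, fun j => ?_, ?_⟩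
        · change (c : ℝ) • (w.1 : Vec m) = _
          rw [h1, smul_smul]
        · change _ ≤ (c : ℝ) * w.2.1 j
          rw [mul_assoc]
          exact mul_le_mul_of_nonneg_left (h2 j) c.2
        · change _ ≤ (c : ℝ) * w.2.2
          rw [mul_assoc]
          exact mul_le_mul_of_nonneg_left h3 c.2
      add_mem' := by
        rintro w w' ⟨t, ht, u, hu, h1, h2, h3⟩ ⟨t', ht', u', hu', h1', h2', h3'⟩
        rcases (add_nonneg ht ht').lt_or_eq with hpos | h0
        · have hne := hpos.ne'
          have ha : 0 ≤ t / (t + t') := div_nonneg ht hpos.le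
          have hb : 0 ≤ t' / (t + t') := div_nonneg ht' hpos.le
          have hab : t / (t + t') + t' / (t + t') = 1 := by rw [← add_div, div_self hne]
          have key : ∀ {g : Vec d → ℝ} (c : ℝ), ConvexOn ℝ C g →
              (t + t') * (g ((t / (t + t')) • u + (t' / (t + t')) • u') - c) ≤
                t * (g u - c) + t' * (g u' - c) := by
            intro g c hg
            have h := mul_le_mul_of_nonneg_left (hg.2 hu hu' ha hb hab) hpos.le
            have e : (t + t') * (t / (t + t') * g u + t' / (t + t') * g u') = t * g u + t' * g u' := by
              field_simp
            simp only [smul_eq_mul] at h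
            rw [e] at h
            linarith
          refine ⟨t + t', hpos.le, (t / (t + t')) • u + (t' / (t + t')) • u',
            hf.1 hu hu' ha hb hab, ?_, fun j => ?_, ?_⟩
          · change (w.1 : Vec m) + (w'.1 : Vec m) = _
            rw [h1, h1', map_add, map_smul, map_smul]
            ext j
            simp only [Pi.add_apply, Pi.smul_apply, Pi.sub_apply, smul_eq_mul]
            field_simp
            ring
          · exact (key _ (hφ j)).trans (add_le_add (h2 j) (h2' j))
          · exact (key _ hf).trans (add_le_add h3 h3')
        · have e : t = 0 := by linarith
          have e' : t' = 0 := by linarith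
          subst e e'
          refine ⟨0, le_rfl, u₀, hu₀C, ?_, fun j => ?_, ?_⟩
          · change (w.1 : Vec m) + (w'.1 : Vec m) = _
            simp [h1, h1']
          · have := add_le_add (h2 j) (h2' j)
            simpa using this
          · have := add_le_add h3 h3'
            simpa using this }
  let F : (E × Vec p × ℝ) →ₗ.[ℝ] ℝ :=
    { domain := LinearMap.ker (LinearMap.fst ℝ E (Vec p × ℝ)) ⊓
        LinearMap.ker ((LinearMap.fst ℝ (Vec p) ℝ).comp (LinearMap.snd ℝ E (Vec p × ℝ)))
      toFun := ((LinearMap.snd ℝ (Vec p) ℝ).comp (LinearMap.snd ℝ E (Vec p × ℝ))).domRestrict _ }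
  have hnonneg : ∀ x : F.domain, (x : E × Vec p × ℝ) ∈ S → 0 ≤ F x := by
    rintro ⟨⟨w1, w2, s⟩, hw1, hw2⟩ ⟨t, ht, u, hu, h1, h2, h3⟩
    change 0 ≤ s
    have e1 : w1 = 0 := hw1
    have e2 : w2 = 0 := hw2
    simp only [e1, e2, ZeroMemClass.coe_zero, Pi.zero_apply] at h1 h2 h3
    rcases ht.lt_or_eq with hpos | rfl
    · have hu1 : A u = a := by
        have := (smul_eq_zero.1 h1.symm).resolve_left hpos.ne'
        exact sub_eq_zero.1 this
      have hu2 : ∀ j, φ j u ≤ q j := fun j => by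
        have := nonpos_of_mul_nonpos_right (h2 j) hpos
        linarith
      exact (mul_nonneg ht (sub_nonneg.2 (hv u hu hu1 hu2))).trans h3
    · simpa using h3
  -- This is where Slater's condition enters: the relative interior allows a step in any direction
  -- `l`, and the strict inequalities absorb any `r`.
  have hdense : ∀ y, ∃ x : F.domain, (x : E × Vec p × ℝ) + y ∈ S := by
    rintro ⟨⟨e, l, hl, rfl⟩, r, s⟩
    obtain ⟨ε, hε, hmem⟩ := exists_pos_smul_mem_of_mem_intrinsicInterior hu₀ hl
    set u₁ := u₀ + ε • l with hu₁
    -- along the segment from `u₀` to `u₁` the slacks stay of order one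
    have hbound : ∃ c : ℝ, 1 ≤ c ∧
        ∀ j, c * (φ j u₀ - q j) + (φ j u₁ - φ j u₀) ≤ ε * r j := by
      have hj : ∀ j, ∃ c : ℝ, ∀ c', c ≤ c' →
          c' * (φ j u₀ - q j) + (φ j u₁ - φ j u₀) ≤ ε * r j := by
        intro j
        have hpos : 0 < q j - φ j u₀ := sub_pos.2 (hq j)
        refine ⟨(φ j u₁ - φ j u₀ - ε * r j) / (q j - φ j u₀), fun c' hc' => ?_⟩
        rw [div_le_iff₀ hpos] at hc'
        linarith
      choose c hc using hj
      refine ⟨1 + ∑ j, |c j|, le_add_of_nonneg_right (Finset.sum_nonneg fun _ _ => abs_nonneg _),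
        fun j => hc j _ ?_⟩
      have := Finset.single_le_sum (f := fun j => |c j|) (fun _ _ => abs_nonneg _)
        (Finset.mem_univ j)
      linarith [le_abs_self (c j)]
    obtain ⟨c, hc1, hc⟩ := hbound
    have hc0 : 0 < c := by linarith
    have ha : 0 ≤ 1 - 1 / c := by
      rw [sub_nonneg, div_le_one hc0]; exact hc1
    have hb : 0 ≤ 1 / c := by positivity
    let u₂ := (1 - 1 / c) • u₀ + (1 / c) • u₁
    have hu₂ : u₂ ∈ C := hf.1 hu₀C hmem ha hb (by ring)
    -- Since `u₂ = u₀ + (ε / c) • l`, scaling by `c / ε` turns the equality residual into exactly `A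
    -- l`. The cost component is free in `F.domain` and is adjusted to match.
    refine ⟨⟨(0, 0, c / ε * (f u₂ - v) - s), rfl, rfl⟩, c / ε, by positivity, u₂, hu₂, ?_,
      fun j => ?_, ?_⟩
    · simp only [u₂, hu₁, Prod.fst_add, zero_add, map_add, map_smul, ← hA]
      ext j
      simp only [Pi.add_apply, Pi.smul_apply, Pi.sub_apply, smul_eq_mul]
      field_simp
      ring
    · have h := (hφ j).2 hu₀C hmem ha hb (by ring)
      simp only [smul_eq_mul] at h
      have h2 : c * (φ j u₂ - q j) ≤ ε * r j := by
        refine le_trans ?_ (hc j)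
        have h3 := mul_le_mul_of_nonneg_left h hc0.le
        have e : c * ((1 - 1 / c) * φ j u₀ + 1 / c * φ j u₁) = c * φ j u₀ + (φ j u₁ - φ j u₀) := by
          field_simp
          ring
        rw [e] at h3
        change c * φ j u₂ ≤ _ at h3
        linarith
      simp only [Prod.snd_add, Prod.fst_add, zero_add]
      rw [div_mul_eq_mul_div, div_le_iff₀ hε]
      linarith
    · simp
  obtain ⟨G, hGF, hGS⟩ := riesz_extension S F hnonneg hdense
  have hG1 : ∀ s : ℝ, G (0, 0, s) = s := fun s => hGF ⟨(0, 0, s), rfl, rfl⟩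
  obtain ⟨Ψ, hΨ⟩ := (G.comp (LinearMap.inl ℝ E (Vec p × ℝ))).exists_extend
  let Z : Vec p →ₗ[ℝ] ℝ := G.comp ((LinearMap.inr ℝ E (Vec p × ℝ)).comp (LinearMap.inl ℝ (Vec p) ℝ))
  have hGsum : ∀ (e : E) (r : Vec p) (s : ℝ), G (e, r, s) = Ψ e + Z r + s := by
    intro e r s
    have h1 : Ψ e = G (e, 0, 0) := LinearMap.congr_fun hΨ e
    have h2 : Z r = G (0, r, 0) := rfl
    have h3 : ((e, r, s) : E × Vec p × ℝ) = (e, 0, 0) + (0, r, 0) + (0, 0, s) := by simp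
    rw [h1, h2, h3, map_add, map_add, hG1]
  refine ⟨fun j => -Ψ (Pi.single j 1), fun j => Z (Pi.single j 1), fun j => ?_, fun u hu => ?_⟩
  · by_contra hneg
    push Not at hneg
    -- The cone is closed upwards in the `j`-th inequality component, so a negative coefficient
    -- there would make `G` negative far along this ray.
    have hray : ∀ c : ℝ, 0 ≤ c → 0 ≤ Z (fun j => φ j u₀ - q j) + c * Z (Pi.single j 1)
        + (f u₀ - v) := by
      intro c hc
      have hm : ((0, (fun j => φ j u₀ - q j) + c • Pi.single j 1, f u₀ - v) : E × Vec p × ℝ) ∈ S := by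
        refine ⟨1, zero_le_one, u₀, hu₀C, by simp [hA], fun i => ?_, by simp⟩
        simp only [one_mul, Pi.add_apply, Pi.smul_apply, smul_eq_mul]
        refine le_add_of_nonneg_right (mul_nonneg hc ?_)
        by_cases h : i = j
        · subst h; simp
        · simp [Pi.single_eq_of_ne h]
      have := hGS _ hm
      rw [hGsum, map_add, map_smul] at this
      simpa using this
    set B := Z (fun j => φ j u₀ - q j) + (f u₀ - v) with hB
    have h := hray ((|B| + 1) / -Z (Pi.single j 1))
      (div_nonneg (by positivity) (by linarith))
    have e : (|B| + 1) / -Z (Pi.single j 1) * Z (Pi.single j 1) = -(|B| + 1) := by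
      have := hneg.ne
      field_simp
    rw [e] at h
    linarith [le_abs_self B]
  · have hm : ((⟨A u - a, hAE u hu⟩, fun j => φ j u - q j, f u - v) : E × Vec p × ℝ) ∈ S :=
      ⟨1, zero_le_one, u, hu, by simp, by simp, by simp⟩
    have h := hGS _ hm
    rw [hGsum] at h
    rw [LinearMap.pi_apply_eq_sum_univ Z, LinearMap.pi_apply_eq_sum_univ Ψ] at h
    have e1 : ∑ j, -Ψ (Pi.single j 1) * (a j - A u j) =
        ∑ i, (A u - a) i • Ψ (fun j => if i = j then 1 else 0) := by
      refine Finset.sum_congr rfl fun i _ => ?_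
      have : (fun j => if i = j then (1 : ℝ) else 0) = Pi.single i 1 := by
        ext j; simp [Pi.single_apply, eq_comm]
      rw [this, smul_eq_mul, Pi.sub_apply]
      ring
    have e2 : ∑ j, Z (Pi.single j 1) * (φ j u - q j) =
        ∑ i, (φ i u - q i) • Z (fun j => if i = j then 1 else 0) := by
      refine Finset.sum_congr rfl fun i _ => ?_
      have : (fun j => if i = j then (1 : ℝ) else 0) = Pi.single i 1 := by
        ext j; simp [Pi.single_apply, eq_comm]
      rw [this, smul_eq_mul]
      ring
    rw [e1, e2]
    simp only [Pi.sub_apply] at h ⊢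
    linarith

/-! ### Real-valued convex Lipschitz models -/

/-- An extended real function that is in fact real-valued, convex and Lipschitz. -/
def IsLipschitzConvex {d : ℕ} (m : Vec d → EReal) : Prop :=
  ∃ g : Vec d → ℝ, (∀ x, m x = g x) ∧ ConvexOn ℝ Set.univ g ∧
    ∃ L : ℝ, 0 ≤ L ∧ ∀ x y, g x ≤ g y + L * ‖x - y‖

theorem isLipschitzConvex_zero {d : ℕ} {m : Vec d → EReal} (h : ∀ x, m x = 0) :
    IsLipschitzConvex m :=
  ⟨fun _ => 0, by simpa using h, convexOn_const 0 convex_univ, 0, le_rfl, by simp⟩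

theorem isLipschitzConvex_affine {d : ℕ} (c : ℝ) (l : Vec d →ₗ[ℝ] ℝ) :
    IsLipschitzConvex fun e => ((c + l e : ℝ) : EReal) := by
  refine ⟨fun e => c + l e, fun _ => rfl, ?_, ‖LinearMap.toContinuousLinearMap l‖, norm_nonneg _,
    fun x y => ?_⟩
  · exact (convexOn_const c convex_univ).add (l.convexOn convex_univ)
  · have h := (LinearMap.toContinuousLinearMap l).le_opNorm (x - y)
    have h2 := le_abs_self (l (x - y))
    rw [Real.norm_eq_abs, LinearMap.coe_toContinuousLinearMap'] at h
    rw [map_sub] at h h2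
    linarith

theorem IsLipschitzConvex.sup {d : ℕ} {m m' : Vec d → EReal} (h : IsLipschitzConvex m)
    (h' : IsLipschitzConvex m') : IsLipschitzConvex fun x => max (m x) (m' x) := by
  obtain ⟨g, hg, hc, L, hL, hl⟩ := h
  obtain ⟨g', hg', hc', L', hL', hl'⟩ := h'
  refine ⟨fun x => max (g x) (g' x), fun x => ?_, hc.sup hc', max L L', le_max_of_le_left hL,
    fun x y => max_le ?_ ?_⟩
  · simp only [hg, hg']
    exact (EReal.coe_strictMono.monotone.map_max).symm
  · refine (hl x y).trans (add_le_add (le_max_left _ _) ?_)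
    exact mul_le_mul_of_nonneg_right (le_max_left _ _) (norm_nonneg _)
  · refine (hl' x y).trans (add_le_add (le_max_right _ _) ?_)
    exact mul_le_mul_of_nonneg_right (le_max_right _ _) (norm_nonneg _)

namespace SAAProblem

variable {P : SAAProblem}

/-! ### Cuts -/

theorem exists_cut_eq_affine (t : ℕ) (i : Fin (P.N (t + 1))) (x : Vec (P.n t)) (v : ℝ)
    (y : Vec (P.m (t + 1))) (z : Vec (P.p (t + 1))) :
    ∃ (c : ℝ) (l : Vec (P.n t) →ₗ[ℝ] ℝ), ∀ e, cut t i x v y z e = c + l e := by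
  let l : Vec (P.n t) →ₗ[ℝ] ℝ := (∑ j, y j • (LinearMap.proj j).comp (P.B t i)) -
    ∑ j, z j • (LinearMap.proj j).comp (P.Q t i)
  refine ⟨v - l x, l, fun e => ?_⟩
  have h : cut t i x v y z e = v + l (e - x) := by
    simp [cut, l, LinearMap.sum_apply, add_sub_assoc]
  rw [h, map_sub]
  ring

theorem isLipschitzConvex_average_cut (t : ℕ) (x : Vec (P.n t)) (v : Fin (P.N (t + 1)) → ℝ)
    (y : Fin (P.N (t + 1)) → Vec (P.m (t + 1))) (z : Fin (P.N (t + 1)) → Vec (P.p (t + 1))) :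
    IsLipschitzConvex fun e =>
      (((P.N (t + 1) : ℝ)⁻¹ * ∑ i, cut t i x (v i) (y i) (z i) e : ℝ) : EReal) := by
  choose c l h using fun i => exists_cut_eq_affine t i x (v i) (y i) (z i)
  have e : ∀ e, (P.N (t + 1) : ℝ)⁻¹ * ∑ i, cut t i x (v i) (y i) (z i) e =
      (P.N (t + 1) : ℝ)⁻¹ * ∑ i, c i + ((P.N (t + 1) : ℝ)⁻¹ • ∑ i, l i) e := by
    intro e
    simp [h, Finset.sum_add_distrib, LinearMap.sum_apply, mul_add]
  simp only [e]
  exact isLipschitzConvex_affine _ _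

theorem cut_self (t : ℕ) (i : Fin (P.N (t + 1))) (x : Vec (P.n t)) (v : ℝ)
    (y : Vec (P.m (t + 1))) (z : Vec (P.p (t + 1))) : cut t i x v y z x = v := by
  simp [cut]

/-- Weak duality: a cut is a global lower bound of the optimal value function. -/
theorem IsValueWithMultipliers.cut_le {t : ℕ} {i : Fin (P.N (t + 1))} {x : Vec (P.n t)}
    {f : Vec (P.n (t + 1)) → EReal} {v : ℝ} {y : Vec (P.m (t + 1))} {z : Vec (P.p (t + 1))}
    (h : IsValueWithMultipliers t i x f v y z) {e : Vec (P.n t)} {u : Vec (P.n (t + 1))}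
    (hu : u ∈ P.feas t i e) : (cut t i x v y z e : EReal) ≤ f u := by
  obtain ⟨-, hz, hv⟩ := h
  obtain ⟨huX, huA, huΦ⟩ := hu
  set r : ℝ := (∑ j, y j * (P.B t i x j + P.b (t + 1) i j - P.A (t + 1) i u j)) +
    ∑ j, z j * (P.Phi (t + 1) i j u - P.Q t i x j) with hr
  have h1 : (v : EReal) ≤ f u + (r : EReal) := by
    rw [← hv]
    exact iInf₂_le u huX
  -- `u` satisfies the constraints at `e`, so its residuals at `x` are determined (equalities) or
  -- bounded above (inequalities) by terms linear in `e - x`; the signs of `z` preserve the bound.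
  have h2 : r ≤ -(∑ j, y j * P.B t i (e - x) j) + ∑ j, z j * P.Q t i (e - x) j := by
    rw [hr, ← Finset.sum_neg_distrib]
    refine add_le_add (Finset.sum_le_sum fun j _ => ?_) (Finset.sum_le_sum fun j _ => ?_)
    · rw [huA, map_sub]
      simp only [Pi.add_apply, Pi.sub_apply]
      linarith
    · refine mul_le_mul_of_nonneg_left ?_ (hz j)
      rw [map_sub, Pi.sub_apply]
      linarith [huΦ j]
  generalize f u = fu at h1 ⊢
  induction fu using EReal.rec with
  | bot => simp at h1
  | top => exact le_top
  | coe a =>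
    rw [← EReal.coe_add, EReal.coe_le_coe_iff] at h1
    rw [EReal.coe_le_coe_iff, cut]
    linarith

/-! ### The value functions and the models -/

theorem coe_lam_nonneg (P : SAAProblem) : (0 : EReal) ≤ (P.lam : EReal) :=
  EReal.coe_nonneg.2 P.lam_pos.le

theorem V_last (x : Vec (P.n P.T)) : P.V P.T x = 0 := by
  simp [V, costToGo]

theorem V_eq {t : ℕ} (ht : t < P.T) (x : Vec (P.n t)) :
    P.V t x = (((P.N (t + 1) : ℝ)⁻¹ : ℝ) : EReal) * ∑ i, ⨅ y ∈ P.feas t i x, P.F (t + 1) i y := by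
  have : P.T - t = (P.T - (t + 1)) + 1 := by omega
  rw [V, this]
  rfl

theorem coe_average {N : ℕ} (c : Fin N → ℝ) : (((N : ℝ)⁻¹ * ∑ i, c i : ℝ) : EReal) =
    (((N : ℝ)⁻¹ : ℝ) : EReal) * ∑ i, (c i : EReal) := by
  rw [EReal.coe_mul]
  congr 1
  exact map_sum (⟨⟨Real.toEReal, rfl⟩, fun _ _ => EReal.coe_add _ _⟩ : ℝ →+ EReal) c Finset.univ

theorem State.Flow_mono {s s' : P.State} {t : ℕ} {i : Fin (P.N t)} {x : Vec (P.n t)}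
    (h : s.model t x ≤ s'.model t x) : s.Flow t i x ≤ s'.Flow t i x :=
  add_le_add le_rfl (mul_le_mul_of_nonneg_left h P.coe_lam_nonneg)

theorem State.Flow_le_F {s : P.State} {t : ℕ} {i : Fin (P.N t)} {x : Vec (P.n t)}
    (h : s.model t x ≤ P.V t x) : s.Flow t i x ≤ P.F t i x :=
  add_le_add le_rfl (mul_le_mul_of_nonneg_left h P.coe_lam_nonneg)

theorem State.F_le_Flow_add {s : P.State} {t : ℕ} {i : Fin (P.N t)} {x : Vec (P.n t)} {e : ℝ}
    (h : P.V t x ≤ s.model t x + (e : EReal)) :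
    P.F t i x ≤ s.Flow t i x + ((P.lam * e : ℝ) : EReal) := by
  have h1 := mul_le_mul_of_nonneg_left h P.coe_lam_nonneg
  rw [EReal.left_distrib_of_nonneg_of_ne_top P.coe_lam_nonneg (EReal.coe_ne_top _),
    ← EReal.coe_mul] at h1
  rw [F, State.Flow, add_assoc]
  exact add_le_add le_rfl h1

theorem average_le {N : ℕ} {a b : Fin N → EReal} (h : ∀ i, a i ≤ b i) :
    (((N : ℝ)⁻¹ : ℝ) : EReal) * ∑ i, a i ≤ (((N : ℝ)⁻¹ : ℝ) : EReal) * ∑ i, b i :=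
  mul_le_mul_of_nonneg_left (Finset.sum_le_sum fun i _ => h i)
    (EReal.coe_nonneg.2 (inv_nonneg.2 (Nat.cast_nonneg _)))

theorem IsBackward.model_le {δ : ℕ → ℝ} {s s' : P.State} {w : P.ForwardPass}
    (h : IsBackward δ s w s') {t : ℕ} (h1 : 1 ≤ t) (hT : t ≤ P.T) (x : Vec (P.n t)) :
    s.model t x ≤ s'.model t x := by
  rcases hT.lt_or_eq with hT | rfl
  · obtain ⟨⟨v, y, z, -, hm⟩, -⟩ := h.2 t h1 hT
    rw [hm]
    exact le_max_left _ _
  · rw [h.1]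

/-- The induction runs down the stages because the cut of stage `t` is computed with the updated
model of stage `t + 1`, whose validity has to be known first. -/
theorem IsBackward.model_le_V {δ : ℕ → ℝ} {s s' : P.State} {w : P.ForwardPass}
    (h : IsBackward δ s w s') (hs : ∀ t, 1 ≤ t → t ≤ P.T → ∀ x, s.model t x ≤ P.V t x)
    {t : ℕ} (h1 : 1 ≤ t) (hT : t ≤ P.T) (x : Vec (P.n t)) : s'.model t x ≤ P.V t x := by
  induction hT using Nat.decreasingInduction with
  | self =>
    rw [h.1]
    exact hs _ h1 le_rfl x
  | of_succ t ht ih =>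
    obtain ⟨⟨v, y, z, hval, hm⟩, -⟩ := h.2 t h1 ht
    rw [hm]
    refine max_le (hs t h1 ht.le x) ?_
    rw [coe_average, V_eq ht]
    exact average_le fun i => le_iInf₂ fun u hu =>
      ((hval i).cut_le hu).trans (State.Flow_le_F (ih (by omega) u))

theorem feas_subset_region {t : ℕ} {i : Fin (P.N (t + 1))} {x : Vec (P.n t)}
    (hx : x ∈ P.region t) : P.feas t i x ⊆ P.region (t + 1) := fun _ hy =>
  Set.mem_iUnion.2 ⟨i, Set.mem_iUnion₂.2 ⟨x, hx, hy⟩⟩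

theorem eq_firstScenario (i : Fin (P.N (0 + 1))) : i = P.firstScenario := by
  have h : P.N (0 + 1) = 1 := P.N_one
  exact Fin.ext (by have := i.2; simp only [firstScenario]; omega)

theorem Regular.feas_nonempty (hreg : P.Regular) {t : ℕ} (ht : t < P.T) {x : Vec (P.n t)}
    (hx : x ∈ P.region t) (i : Fin (P.N (t + 1))) : (P.feas t i x).Nonempty := by
  rcases Nat.eq_zero_or_pos t with rfl | h1
  · obtain rfl : x = 0 := hx
    rw [eq_firstScenario i]
    exact hreg.1
  · obtain ⟨r, hr, h⟩ := hreg.2 t h1 ht.le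
    obtain ⟨u, hu⟩ := (h x ⟨x, hx, 0, Submodule.zero_mem _, by simpa using hr.le, by simp⟩).2 ht i
    exact ⟨u, intrinsicInterior_subset hu⟩

theorem Regular.H_lt_top (hreg : P.Regular) {t : ℕ} (h1 : 1 ≤ t) (ht : t ≤ P.T) {x : Vec (P.n t)}
    (hx : x ∈ P.region t) (i : Fin (P.N t)) : P.H t i x < ⊤ := by
  obtain ⟨r, hr, h⟩ := hreg.2 t h1 ht
  exact (h x ⟨x, hx, 0, Submodule.zero_mem _, by simpa using hr.le, by simp⟩).1 i

theorem coe_mul_lt_top {c : ℝ} (hc : 0 ≤ c) {a : EReal} (ha : a < ⊤) : (c : EReal) * a < ⊤ := by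
  induction a using EReal.rec with
  | bot => rcases hc.lt_or_eq with hc | rfl
           · rw [EReal.coe_mul_bot_of_pos hc]; exact bot_lt_top
           · simp
  | coe a => rw [← EReal.coe_mul]; exact EReal.coe_lt_top _
  | top => exact absurd rfl ha.ne

theorem sum_lt_top {ι : Type*} (A : Finset ι) {a : ι → EReal} (ha : ∀ i, a i < ⊤) :
    ∑ i ∈ A, a i < ⊤ :=
  Finset.sum_induction _ (· < ⊤) (fun _ _ h h' => EReal.add_lt_top h.ne h'.ne)
    EReal.zero_lt_top fun i _ => ha i

theorem Regular.V_lt_top (hreg : P.Regular) {t : ℕ} (h1 : 1 ≤ t) (hT : t ≤ P.T)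
    {x : Vec (P.n t)} (hx : x ∈ P.region t) : P.V t x < ⊤ := by
  induction hT using Nat.decreasingInduction with
  | self => rw [V_last]; exact EReal.zero_lt_top
  | of_succ t ht ih =>
    rw [V_eq ht]
    refine coe_mul_lt_top (inv_nonneg.2 (Nat.cast_nonneg _)) (sum_lt_top _ fun i => ?_)
    obtain ⟨y, hy⟩ := hreg.feas_nonempty ht hx i
    have hy' := feas_subset_region hx hy
    refine (iInf₂_le y hy).trans_lt (EReal.add_lt_top
      (hreg.H_lt_top (by omega) (by omega) hy' i).ne ?_)
    exact (coe_mul_lt_top P.lam_pos.le (ih (by omega) hy')).ne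

theorem Regular.F_lt_top (hreg : P.Regular) {t : ℕ} (h1 : 1 ≤ t) (hT : t ≤ P.T)
    {x : Vec (P.n t)} (hx : x ∈ P.region t) (i : Fin (P.N t)) : P.F t i x < ⊤ :=
  EReal.add_lt_top (hreg.H_lt_top h1 hT hx i).ne
    (coe_mul_lt_top P.lam_pos.le (hreg.V_lt_top h1 hT hx)).ne

theorem IsForward.x_mem_region {s : P.State} {w : P.ForwardPass} (h : IsForward s w) {t : ℕ}
    (ht : t ≤ P.T) : w.x t ∈ P.region t := by
  induction t with
  | zero => exact h.1
  | succ t ih =>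
    obtain ⟨hc, i, hi, -⟩ := h.2 t ht
    rw [hi]
    exact feas_subset_region (ih (by omega)) (hc i).1

theorem IsForward.cand_mem_region {s : P.State} {w : P.ForwardPass} (h : IsForward s w) {t : ℕ}
    (ht : t < P.T) (i : Fin (P.N (t + 1))) : w.cand (t + 1) i ∈ P.region (t + 1) :=
  feas_subset_region (h.x_mem_region ht.le) ((h.2 t ht).1 i).1

/-! ### Invariants of an execution -/

theorem not_stops_initState {δ : ℕ → ℝ} {w : P.ForwardPass} (hT : 1 < P.T) :
    ¬ Stops δ P.initState w := by
  simp [Stops, State.gap, initState, hT]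

section Execution

variable {δ : ℕ → ℝ} {K : ℕ} {s : ℕ → P.State} {w : ℕ → P.ForwardPass}

theorem IsExecution.model_last (h : P.IsExecution δ K s w) {k : ℕ} (hk : k ≤ K)
    (x : Vec (P.n P.T)) : (s k).model P.T x = 0 := by
  induction k with
  | zero => rw [h.1]; simp [initState]
  | succ k ih =>
    obtain ⟨-, hst, hb⟩ := h.2.1 k hk
    by_cases hs : Stops δ (s k) (w (k + 1))
    · rw [hst hs]; exact ih (by omega)
    · rw [(hb hs).1]; exact ih (by omega)

/-- With no saturated points the gap is `⊤`, so for `T > 1` the first test fails. This guarantees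
that a backward phase has replaced the `-∞` models before any stop, which leaves the state
unchanged. -/
theorem IsExecution.one_le_of_stops (h : P.IsExecution δ K s w) {k : ℕ}
    (hs : Stops δ (s k) (w (k + 1))) : P.T = 1 ∨ 1 ≤ k := by
  by_contra hne
  push Not at hne
  obtain rfl : k = 0 := by omega
  rw [h.1] at hs
  exact not_stops_initState (lt_of_le_of_ne P.one_le_T (Ne.symm hne.1)) hs

theorem IsExecution.model_cases (h : P.IsExecution δ K s w) {k : ℕ} (hk : k ≤ K) {t : ℕ}
    (h1 : 1 ≤ t) (hT : t ≤ P.T) :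
    IsLipschitzConvex ((s k).model t) ∨ (k = 0 ∧ t < P.T ∧ ∀ x, (s k).model t x = ⊥) := by
  rcases hT.eq_or_lt with rfl | hT
  · exact Or.inl (isLipschitzConvex_zero (h.model_last hk))
  induction k with
  | zero =>
    refine Or.inr ⟨rfl, hT, fun x => ?_⟩
    rw [h.1]; simp [initState, hT]
  | succ k ih =>
    left
    obtain ⟨-, hst, hb⟩ := h.2.1 k hk
    by_cases hs : Stops δ (s k) (w (k + 1))
    · rw [hst hs]
      refine (ih (by omega)).resolve_right fun h0 => ?_
      have := h.one_le_of_stops hs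
      omega
    · obtain ⟨⟨v, y, z, -, hm⟩, -⟩ := (hb hs).2 t h1 hT
      have hc := isLipschitzConvex_average_cut t ((w (k + 1)).x t) v y z
      rw [funext hm]
      rcases ih (by omega) with hg | ⟨-, -, hbot⟩
      · exact hg.sup hc
      · simpa [hbot] using hc

theorem IsExecution.isLipschitzConvex (h : P.IsExecution δ K s w) {k : ℕ} (h0 : 1 ≤ k)
    (hk : k ≤ K) {t : ℕ} (h1 : 1 ≤ t) (hT : t ≤ P.T) : IsLipschitzConvex ((s k).model t) :=
  (h.model_cases hk h1 hT).resolve_right fun h' => by omega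

theorem IsExecution.model_le_V (h : P.IsExecution δ K s w) {k : ℕ} (hk : k ≤ K) :
    ∀ t, 1 ≤ t → t ≤ P.T → ∀ x, (s k).model t x ≤ P.V t x := by
  induction k with
  | zero =>
    intro t h1 hT x
    rw [h.1]
    rcases hT.lt_or_eq with hT | rfl
    · simp [initState, hT]
    · simp [initState, V_last]
  | succ k ih =>
    obtain ⟨-, hst, hb⟩ := h.2.1 k hk
    by_cases hs : Stops δ (s k) (w (k + 1))
    · rw [hst hs]; exact ih (by omega)
    · exact fun t h1 hT x => (hb hs).model_le_V (ih (by omega)) h1 hT x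

theorem IsExecution.exists_modelLipschitzBound {D : ℕ → ℝ} (h : P.IsExecution δ K s w)
    (hD : P.DiameterBound D) (hreg : P.Regular) : ∃ Mlow : ℕ → ℝ, P.ModelLipschitzBound K s Mlow := by
  have key : ∀ t, ∃ L : ℝ, 1 ≤ t → t ≤ P.T → 0 ≤ L ∧
      ∀ k, 1 ≤ k → k ≤ K → ∀ i, ∀ x ∈ P.region t, ∀ x' ∈ P.region t,
      (s k).Flow t i x ≤ (s k).Flow t i x' + ((L * ‖x - x'‖ : ℝ) : EReal) := by
    intro t
    by_cases ht : 1 ≤ t ∧ t ≤ P.T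
    swap
    · exact ⟨0, fun h1 hT => absurd ⟨h1, hT⟩ ht⟩
    obtain ⟨h1, hT⟩ := ht
    obtain ⟨r, hr, hfin⟩ := hreg.2 t h1 hT
    choose LH hLH0 hLH using fun i => (P.H_closedConvex t i).exists_lipschitz hr (hD t h1 hT).2
      fun x hx => (hfin x hx).1 i
    have hm : ∀ k, ∃ L : ℝ, 0 ≤ L ∧ (1 ≤ k → k ≤ K → ∃ g : Vec (P.n t) → ℝ,
        (∀ x, (s k).model t x = g x) ∧ ∀ x y, g x ≤ g y + L * ‖x - y‖) := by
      intro k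
      by_cases hk : 1 ≤ k ∧ k ≤ K
      · obtain ⟨g, hg, -, L, hL, hgl⟩ := h.isLipschitzConvex hk.1 hk.2 h1 hT
        exact ⟨L, hL, fun _ _ => ⟨g, hg, hgl⟩⟩
      · exact ⟨0, le_rfl, fun h h' => absurd ⟨h, h'⟩ hk⟩
    choose Lm hLm0 hLm using hm
    -- Sums serve as common upper bounds over the finitely many scenarios and iterations.
    refine ⟨∑ i, LH i + P.lam * ∑ k ∈ Finset.range (K + 1), Lm k, fun _ _ => ⟨?_, ?_⟩⟩
    · exact add_nonneg (Finset.sum_nonneg fun i _ => hLH0 i)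
        (mul_nonneg P.lam_pos.le (Finset.sum_nonneg fun k _ => hLm0 k))
    · intro k hk1 hkK i x hx x' hx'
      obtain ⟨g, hg, hgl⟩ := hLm k hk1 hkK
      rw [State.Flow, State.Flow, hg, hg, add_mul, EReal.coe_add, add_add_add_comm]
      refine add_le_add ((hLH i x hx x' hx').trans (add_le_add le_rfl ?_)) ?_
      · refine EReal.coe_le_coe_iff.2 (mul_le_mul_of_nonneg_right ?_ (norm_nonneg _))
        exact Finset.single_le_sum (f := LH) (fun i _ => hLH0 i) (Finset.mem_univ i)
      · rw [← EReal.coe_mul, ← EReal.coe_mul, ← EReal.coe_add, EReal.coe_le_coe_iff, mul_assoc,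
          ← mul_add]
        refine mul_le_mul_of_nonneg_left ((hgl x x').trans (add_le_add le_rfl ?_)) P.lam_pos.le
        refine mul_le_mul_of_nonneg_right ?_ (norm_nonneg _)
        exact Finset.single_le_sum (f := Lm) (fun k _ => hLm0 k)
          (Finset.mem_range.2 (by omega))
  choose L hL using key
  exact ⟨L, hL⟩

/-! ### The accuracy at termination -/

theorem eps_last {M Mlow : ℕ → ℝ} {t : ℕ} (ht : P.T ≤ t + 1) : P.eps M Mlow δ t = 0 := by
  rw [eps, Finset.Ico_eq_empty (by omega), Finset.sum_empty]

theorem eps_succ {M Mlow : ℕ → ℝ} {t : ℕ} (ht : t + 1 < P.T) :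
    P.eps M Mlow δ t = (M (t + 1) + Mlow (t + 1)) * δ (t + 1) +
      P.lam * P.eps M Mlow δ (t + 1) := by
  rw [eps, Finset.sum_eq_sum_Ico_succ_bot (by omega), eps, Finset.mul_sum]
  congr 1
  · simp
  · refine Finset.sum_congr rfl fun τ hτ => ?_
    rw [Finset.mem_Ico] at hτ
    have : τ - t = τ - (t + 1) + 1 := by omega
    rw [this, pow_succ]
    ring

/-- A point that is not distinguishable from the saturated ones has a small model error. -/
theorem IsExecution.F_le_Flow_of_gap_le {M Mlow : ℕ → ℝ} (h : P.IsExecution δ K s w)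
    (hM : P.LipschitzBound M) (hMlow : P.ModelLipschitzBound K s Mlow)
    (hδ : ∀ t, 1 ≤ t → t ≤ P.T → 0 ≤ δ t) {k : ℕ} (hk : k ≤ K) {t : ℕ} (ht : t < P.T)
    (hfin : t + 1 < P.T → ((s k).sat (t + 1)).Finite)
    (hsat : t + 1 < P.T → ∀ x ∈ (s k).sat (t + 1), 1 ≤ k ∧ x ∈ P.region (t + 1) ∧
      P.V (t + 1) x ≤ (s k).model (t + 1) x + (P.eps M Mlow δ (t + 1) : EReal))
    {c : Vec (P.n (t + 1))} (hc : c ∈ P.region (t + 1))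
    (hgap : (s k).gap (t + 1) c ≤ ENNReal.ofReal (δ (t + 1))) (i : Fin (P.N (t + 1))) :
    P.F (t + 1) i c ≤ (s k).Flow (t + 1) i c + (P.eps M Mlow δ t : EReal) := by
  rcases (Nat.succ_le_of_lt ht).lt_or_eq with hT | hT
  · replace hT : t + 1 < P.T := hT
    rw [State.gap, if_pos hT] at hgap
    have hne : ((s k).sat (t + 1)).Nonempty := by
      by_contra hempty
      rw [Set.not_nonempty_iff_eq_empty.1 hempty, Metric.infEDist_empty, top_le_iff] at hgap
      exact ENNReal.ofReal_ne_top hgap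
    obtain ⟨x, hx, hxc⟩ := (hfin hT).isCompact.exists_infEDist_eq_edist hne c
    rw [hxc, edist_dist, dist_eq_norm, ENNReal.ofReal_le_ofReal_iff (hδ _ (by omega) hT.le)] at hgap
    obtain ⟨hk1, hxr, hxV⟩ := hsat hT x hx
    obtain ⟨hM0, hMl⟩ := hM (t + 1) (by omega) hT.le
    obtain ⟨hm0, hml⟩ := hMlow (t + 1) (by omega) hT.le
    have e1 := hMl i c hc x hxr
    have e2 : P.F (t + 1) i x ≤ _ := State.F_le_Flow_add (i := i) hxV
    have e3 := hml k hk1 hk i x hxr c hc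
    calc P.F (t + 1) i c ≤ P.F (t + 1) i x + ((M (t + 1) * ‖c - x‖ : ℝ) : EReal) := e1
      _ ≤ (((s k).Flow (t + 1) i c + ((Mlow (t + 1) * ‖x - c‖ : ℝ) : EReal)) +
          ((P.lam * P.eps M Mlow δ (t + 1) : ℝ) : EReal)) +
          ((M (t + 1) * ‖c - x‖ : ℝ) : EReal) :=
        add_le_add (e2.trans (add_le_add e3 le_rfl)) le_rfl
      _ ≤ _ := by
        rw [add_assoc, add_assoc, ← EReal.coe_add, ← EReal.coe_add]
        refine add_le_add le_rfl (EReal.coe_le_coe_iff.2 ?_)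
        rw [eps_succ hT, norm_sub_rev x c]
        nlinarith [mul_le_mul_of_nonneg_left hgap hM0, mul_le_mul_of_nonneg_left hgap hm0]
  · rw [eps_last (by omega), EReal.coe_zero, add_zero]
    replace hT : t + 1 = P.T := hT
    refine add_le_add le_rfl (mul_le_mul_of_nonneg_left (le_of_eq ?_) P.coe_lam_nonneg)
    -- At the last stage the model is exact. Generalizing the index to `r` allows substitution
    -- despite the dependent type of `x`.
    have hV : ∀ r, r = P.T → ∀ x : Vec (P.n r), P.V r x = (s k).model r x := by
      rintro r rfl x
      rw [V_last, h.model_last hk]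
    exact hV _ hT c

/-- Old points keep their bound because models only grow. For a new point the gap of stage `t + 1`
is measured against the points saturated before the iteration, so induction on `k` alone suffices.
The clause `1 ≤ k` makes the Lipschitz constants of the models available wherever a saturated point
exists. -/
theorem IsExecution.sat_spec {M Mlow : ℕ → ℝ} (h : P.IsExecution δ K s w)
    (hM : P.LipschitzBound M) (hMlow : P.ModelLipschitzBound K s Mlow)
    (hδ : ∀ t, 1 ≤ t → t ≤ P.T → 0 ≤ δ t) {k : ℕ} (hk : k ≤ K) :
    ∀ t, 1 ≤ t → t < P.T → ((s k).sat t).Finite ∧ ∀ x ∈ (s k).sat t, 1 ≤ k ∧ x ∈ P.region t ∧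
      P.V t x ≤ (s k).model t x + (P.eps M Mlow δ t : EReal) := by
  induction k with
  | zero =>
    intro t _ _
    rw [h.1]
    simp [initState]
  | succ k ih =>
    intro t h1 hT
    obtain ⟨hf, hst, hb⟩ := h.2.1 k hk
    specialize ih (by omega)
    by_cases hs : Stops δ (s k) (w (k + 1))
    · rw [hst hs]
      refine ⟨(ih t h1 hT).1, fun x hx => ?_⟩
      obtain ⟨_, h'⟩ := (ih t h1 hT).2 x hx
      exact ⟨by omega, h'⟩
    specialize hb hs
    have hold : ∀ x ∈ (s k).sat t, 1 ≤ k + 1 ∧ x ∈ P.region t ∧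
        P.V t x ≤ (s (k + 1)).model t x + (P.eps M Mlow δ t : EReal) := by
      intro x hx
      obtain ⟨_, hr, hV⟩ := (ih t h1 hT).2 x hx
      exact ⟨by omega, hr, hV.trans (add_le_add (hb.model_le h1 hT.le x) le_rfl)⟩
    obtain ⟨⟨v, y, z, hval, hm⟩, hins, hkeep⟩ := hb.2 t h1 hT
    by_cases hg : (s k).gap (t + 1) ((w (k + 1)).x (t + 1)) ≤ ENNReal.ofReal (δ (t + 1))
    swap
    · rw [hkeep hg]
      exact ⟨(ih t h1 hT).1, hold⟩
    rw [hins hg]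
    refine ⟨(ih t h1 hT).1.insert _, fun x hx => ?_⟩
    rcases hx with rfl | hx
    swap
    · exact hold x hx
    refine ⟨by omega, hf.x_mem_region hT.le, ?_⟩
    obtain ⟨hcand, i₀, hi₀, hmax⟩ := hf.2 t hT
    set e := P.eps M Mlow δ t
    have hN : (P.N (t + 1) : ℝ) ≠ 0 := Nat.cast_ne_zero.2 (P.N_pos (t + 1)).ne'
    calc P.V t ((w (k + 1)).x t)
        ≤ (((P.N (t + 1) : ℝ)⁻¹ : ℝ) : EReal) * ∑ i, ((v i + e : ℝ) : EReal) := by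
          rw [V_eq hT]
          refine average_le fun i => (iInf₂_le _ (hcand i).1).trans ?_
          -- The chosen point has the largest gap, so every candidate `i` passes the test. Its value
          -- in the old model is then at most `v i`, the optimal value for the larger new model.
          refine (h.F_le_Flow_of_gap_le hM hMlow hδ (by omega) hT
            (fun hT' => (ih _ (by omega) hT').1) (fun hT' => (ih _ (by omega) hT').2)
            (hf.cand_mem_region hT i) ((hmax i).trans hg) i).trans ?_
          rw [EReal.coe_add]
          refine add_le_add ?_ le_rfl
          rw [← (hval i).1]
          exact le_iInf₂ fun u hu => ((hcand i).2 u hu).trans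
            (State.Flow_mono (hb.model_le (by omega) hT u))
      _ = (((P.N (t + 1) : ℝ)⁻¹ * ∑ i, v i : ℝ) : EReal) + (e : EReal) := by
          rw [← coe_average, ← EReal.coe_add, Finset.sum_add_distrib, Finset.sum_const,
            Finset.card_univ, Fintype.card_fin, nsmul_eq_mul, mul_add, inv_mul_cancel_left₀ hN]
      _ ≤ _ := by
          rw [hm]
          simp only [cut_self]
          exact add_le_add (le_max_right _ _) le_rfl

theorem IsExecution.isApproxSol {M Mlow : ℕ → ℝ} (h : P.IsExecution δ K s w)
    (hreg : P.Regular) (hM : P.LipschitzBound M) (hMlow : P.ModelLipschitzBound K s Mlow)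
    (hδ : ∀ t, 1 ≤ t → t ≤ P.T → 0 ≤ δ t) (hstopped : P.StoppedAt δ K s w) :
    P.IsApproxSol ((w K).x 1) (P.eps M Mlow δ 0) := by
  obtain ⟨k, rfl, hs⟩ := hstopped
  have hT : 0 < P.T := P.one_le_T
  have hf := (h.2.1 k (by omega)).1
  obtain ⟨hcand, i, hi, -⟩ := hf.2 0 hT
  obtain rfl := eq_firstScenario i
  obtain ⟨hmem, hmin⟩ := hcand P.firstScenario
  rw [← hi, hf.1] at hmem
  rw [← hi, hf.1] at hmin
  have hxr : (w (k + 1)).x (0 + 1) ∈ P.region 1 := hf.x_mem_region P.one_le_T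
  have hlow : (s k).Flow 1 P.firstScenario ((w (k + 1)).x 1) ≤ P.Fstar :=
    le_iInf₂ fun y hy => (hmin y hy).trans
      (State.Flow_le_F (h.model_le_V (by omega) 1 le_rfl P.one_le_T y))
  -- A real-valued model at the stop excludes `Fstar = ⊥`, since `Fstar` is bounded below by the
  -- model value at the minimizer.
  have hgood : IsLipschitzConvex ((s k).model 1) := by
    refine (h.model_cases (by omega) le_rfl P.one_le_T).resolve_right fun h' => ?_
    have := h.one_le_of_stops hs
    omega
  obtain ⟨g, hg, -⟩ := hgood
  refine ⟨hmem, fun hbot => ?_, ?_, ?_⟩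
  · rw [hbot, le_bot_iff, State.Flow, hg, ← EReal.coe_mul, EReal.add_eq_bot_iff] at hlow
    rcases hlow with h' | h'
    · exact (P.H_closedConvex 1 P.firstScenario).1 _ h'
    · exact EReal.coe_ne_bot _ h'
  · exact ((iInf₂_le _ hmem).trans_lt (hreg.F_lt_top le_rfl P.one_le_T hxr P.firstScenario)).ne
  · have hspec := h.sat_spec hM hMlow hδ (k := k) (by omega)
    exact (h.F_le_Flow_of_gap_le hM hMlow hδ (by omega) hT (fun hT' => (hspec _ le_rfl hT').1)
      (fun hT' => (hspec _ le_rfl hT').2) hxr hs P.firstScenario).trans (add_le_add hlow le_rfl)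

/-! ### The number of iterations -/

/-- The saturated points that are distinguishable when they are found. -/
theorem IsExecution.exists_separated (h : P.IsExecution δ K s w)
    (hδ : ∀ t, 1 ≤ t → t ≤ P.T → 0 ≤ δ t) {k : ℕ} (hk : k ≤ K)
    (hns : ∀ j < k, ¬ Stops δ (s j) (w (j + 1))) :
    ∃ R : ∀ t, Finset (Vec (P.n t)),
      (∀ t, 1 ≤ t → t < P.T → (R t : Set (Vec (P.n t))) ⊆ (s k).sat t ∩ P.region t ∧
        ∀ x ∈ R t, ∀ y ∈ R t, x ≠ y → δ t < ‖x - y‖) ∧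
      k ≤ ∑ t ∈ Finset.Ico 1 P.T, (R t).card := by
  classical
  induction k with
  | zero => exact ⟨fun _ => ∅, by simp, by simp⟩
  | succ k ih =>
    obtain ⟨R, hR, hcard⟩ := ih (by omega) fun j hj => hns j (by omega)
    obtain ⟨hf, -, hb⟩ := h.2.1 k hk
    have hs := hns k (by omega)
    specialize hb hs
    -- The test fails at stage `1` and holds trivially at stage `T`, so somewhere it switches from
    -- failing to holding.
    have hex : ∃ t, 1 ≤ t ∧ t < P.T ∧
        ¬ (s k).gap t ((w (k + 1)).x t) ≤ ENNReal.ofReal (δ t) ∧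
        (s k).gap (t + 1) ((w (k + 1)).x (t + 1)) ≤ ENNReal.ofReal (δ (t + 1)) := by
      by_contra hno
      push Not at hno
      have : ∀ t, 1 ≤ t → t ≤ P.T → ENNReal.ofReal (δ t) < (s k).gap t ((w (k + 1)).x t) := by
        intro t h1
        induction t, h1 using Nat.le_induction with
        | base => exact fun _ => not_le.1 hs
        | succ t h1 ih => exact fun hT => hno t h1 hT (ih (by omega))
      have hlast := this P.T P.one_le_T le_rfl
      simp [State.gap] at hlast
    obtain ⟨t, h1, hT, hfar, hnear⟩ := hex
    have hsub : ∀ r, 1 ≤ r → r < P.T → (s k).sat r ⊆ (s (k + 1)).sat r := by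
      intro r hr1 hrT
      obtain ⟨-, hins, hkeep⟩ := hb.2 r hr1 hrT
      by_cases hg : (s k).gap (r + 1) ((w (k + 1)).x (r + 1)) ≤ ENNReal.ofReal (δ (r + 1))
      · rw [hins hg]; exact Set.subset_insert _ _
      · rw [hkeep hg]
    set x := (w (k + 1)).x t with hx
    rw [State.gap, if_pos hT, not_le] at hfar
    have hdist : ∀ y ∈ R t, δ t < ‖x - y‖ := by
      intro y hy
      have := hfar.trans_le (Metric.infEDist_le_edist_of_mem ((hR t h1 hT).1 hy).1)
      rw [edist_dist, dist_eq_norm] at this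
      exact (ENNReal.ofReal_lt_ofReal_iff_of_nonneg (hδ t h1 hT.le)).1 this
    have hxR : x ∉ R t := fun hx => by
      have := hdist x hx
      rw [sub_self, norm_zero] at this
      exact absurd (hδ t h1 hT.le) (not_le.2 this)
    -- Only this one point is recorded. Other points saturated in the same iteration may be close to
    -- old ones and would spoil the separation.
    refine ⟨Function.update R t (insert x (R t)), fun r hr1 hrT => ?_, ?_⟩
    · by_cases hrt : r = t
      · subst hrt
        rw [Function.update_self]
        refine ⟨?_, ?_⟩
        · rw [Finset.coe_insert, Set.insert_subset_iff]
          refine ⟨⟨?_, hf.x_mem_region hT.le⟩, fun y hy => ?_⟩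
          · rw [(hb.2 r hr1 hrT).2.1 hnear]; exact Set.mem_insert _ _
          · exact ⟨hsub r hr1 hrT ((hR r hr1 hrT).1 hy).1, ((hR r hr1 hrT).1 hy).2⟩
        · intro a ha b hb' hab
          rcases Finset.mem_insert.1 ha with rfl | ha <;>
            rcases Finset.mem_insert.1 hb' with rfl | hb'
          · exact absurd rfl hab
          · exact hdist b hb'
          · rw [norm_sub_rev]; exact hdist a ha
          · exact (hR r hr1 hrT).2 a ha b hb' hab
      · rw [Function.update_of_ne hrt]
        exact ⟨fun y hy => ⟨hsub r hr1 hrT ((hR r hr1 hrT).1 hy).1, ((hR r hr1 hrT).1 hy).2⟩,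
          (hR r hr1 hrT).2⟩
    · refine Nat.succ_le_of_lt (hcard.trans_lt (Finset.sum_lt_sum (fun r _ => ?_)
        ⟨t, Finset.mem_Ico.2 ⟨h1, hT⟩, ?_⟩))
      · by_cases hrt : r = t
        · subst hrt
          rw [Function.update_self]
          exact Finset.card_le_card (Finset.subset_insert _ _)
        · rw [Function.update_of_ne hrt]
      · rw [Function.update_self, Finset.card_insert_of_notMem hxR]
        exact Nat.lt_succ_self _

theorem IsExecution.le_iterBound_of_not_stops {D : ℕ → ℝ} (h : P.IsExecution δ K s w)
    (hD : P.DiameterBound D) (hδ : ∀ t, 1 ≤ t → t ≤ P.T → 0 ≤ δ t) {k : ℕ} (hk : k ≤ K)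
    (hns : ∀ j < k, ¬ Stops δ (s j) (w (j + 1))) : (k : ℝ≥0∞) ≤ P.iterBound D δ := by
  obtain ⟨R, hR, hcard⟩ := h.exists_separated hδ hk hns
  have h1 : (k : ℝ≥0∞) ≤ ∑ t ∈ Finset.Ico 1 P.T, ((R t).card : ℝ≥0∞) := by exact_mod_cast hcard
  refine h1.trans (Finset.sum_le_sum fun t ht => ?_)
  rw [Finset.mem_Ico] at ht
  obtain ⟨hsub, hsep⟩ := hR t ht.1 ht.2
  obtain ⟨hD0, hdiam⟩ := hD t ht.1 ht.2.le
  exact card_le_of_separated (hδ t ht.1 ht.2.le) hD0 (R t)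
    (fun x hx y hy => hdiam x (hsub hx).2 y (hsub hy).2) hsep

theorem IsExecution.not_stops (h : P.IsExecution δ K s w) (hns : ¬ P.StoppedAt δ K s w) {k : ℕ}
    (hk : k < K) : ¬ Stops δ (s k) (w (k + 1)) := by
  rcases (Nat.succ_le_of_lt hk).lt_or_eq with hk | rfl
  · exact h.2.2 k hk
  · exact fun hs => hns ⟨k, rfl, hs⟩

theorem IsExecution.le_iterBound {D : ℕ → ℝ} (h : P.IsExecution δ K s w)
    (hD : P.DiameterBound D) (hδ : ∀ t, 1 ≤ t → t ≤ P.T → 0 ≤ δ t)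
    (hns : ¬ P.StoppedAt δ K s w) : (K : ℝ≥0∞) ≤ P.iterBound D δ :=
  h.le_iterBound_of_not_stops hD hδ le_rfl fun _ => h.not_stops hns

theorem IsExecution.le_iterBound_add_one {D : ℕ → ℝ} (h : P.IsExecution δ K s w)
    (hD : P.DiameterBound D) (hδ : ∀ t, 1 ≤ t → t ≤ P.T → 0 ≤ δ t) :
    (K : ℝ≥0∞) ≤ P.iterBound D δ + 1 := by
  rcases K with _ | k
  · simp
  · rw [Nat.cast_succ]
    gcongr
    -- Only the last iteration can have stopped; all earlier ones are counted by the bound.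
    exact h.le_iterBound_of_not_stops hD hδ (Nat.le_succ k) fun j hj => h.2.2 j (by omega)

end Execution

/-! ### Uniform parameters -/

theorem iterBound_le_uniformIterBound {D δ : ℕ → ℝ} {n : ℕ} {Dmax ε : ℝ}
    (h : ∀ t, 1 ≤ t → t ≤ P.T → P.n t ≤ n ∧ D t ≤ Dmax ∧ δ t = ε) :
    P.iterBound D δ ≤ P.uniformIterBound n Dmax ε := by
  have hterm : ∀ t ∈ Finset.Ico 1 P.T,
      (ENNReal.ofReal (D t) / ENNReal.ofReal (δ t) + 1) ^ P.n t ≤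
        (ENNReal.ofReal Dmax / ENNReal.ofReal ε + 1) ^ n := by
    intro t ht
    rw [Finset.mem_Ico] at ht
    obtain ⟨hn, hD, rfl⟩ := h t ht.1 ht.2.le
    refine le_trans ?_ (pow_le_pow_right₀ le_add_self hn)
    gcongr
  refine (Finset.sum_le_sum hterm).trans (le_of_eq ?_)
  rw [Finset.sum_const, Nat.card_Ico, nsmul_eq_mul]
  rfl

theorem geom_sum_le_horizonFactor (P : SAAProblem) :
    ∑ τ ∈ Finset.range (P.T - 1), P.lam ^ τ ≤ P.horizonFactor := by
  have hcount : ∑ τ ∈ Finset.range (P.T - 1), P.lam ^ τ ≤ (P.T : ℝ) - 1 := by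
    have := Finset.sum_le_card_nsmul (Finset.range (P.T - 1)) (fun τ => P.lam ^ τ) 1
      fun τ _ => pow_le_one₀ P.lam_pos.le P.lam_le_one
    rw [Finset.card_range, nsmul_eq_mul, mul_one, Nat.cast_sub P.one_le_T, Nat.cast_one] at this
    exact this
  rw [horizonFactor]
  split_ifs with hl
  · refine le_min ?_ hcount
    rw [geom_sum_eq hl.ne, ← neg_div_neg_eq]
    refine div_le_div_of_nonneg_right ?_ (by linarith) |>.trans_eq (by rw [neg_sub])
    linarith [pow_pos P.lam_pos (P.T - 1)]
  · exact hcount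

theorem eps_zero_le {M Mlow δ : ℕ → ℝ} {Mmax ε : ℝ} (hM : 0 ≤ Mmax) (hε : 0 ≤ ε)
    (h : ∀ t, 1 ≤ t → t ≤ P.T → max (M t) (Mlow t) ≤ Mmax ∧ δ t = ε) :
    P.eps M Mlow δ 0 ≤ 2 * Mmax * P.horizonFactor * ε := by
  have h1 : P.eps M Mlow δ 0 ≤ ∑ τ ∈ Finset.range (P.T - 1), 2 * Mmax * ε * P.lam ^ τ := by
    rw [eps, ← Finset.range_eq_Ico]
    refine Finset.sum_le_sum fun τ hτ => ?_
    rw [Finset.mem_range] at hτ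
    obtain ⟨hm, hd⟩ := h (τ + 1) (by omega) (by omega)
    rw [hd, Nat.sub_zero]
    refine mul_le_mul_of_nonneg_right (mul_le_mul_of_nonneg_right ?_ hε) (pow_nonneg P.lam_pos.le _)
    linarith [(le_max_left _ _).trans hm, (le_max_right _ _).trans hm]
  rw [← Finset.mul_sum] at h1
  refine h1.trans ((mul_le_mul_of_nonneg_left P.geom_sum_le_horizonFactor
    (by positivity)).trans_eq (by ring))

theorem IsApproxSol.mono {x : Vec (P.n 1)} {e e' : ℝ} (h : P.IsApproxSol x e) (he : e ≤ e') :
    P.IsApproxSol x e' :=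
  ⟨h.1, h.2.1, h.2.2.1, h.2.2.2.trans (add_le_add le_rfl (EReal.coe_le_coe_iff.2 he))⟩

/-! ### Existence of a further iteration -/

theorem isClosed_feas (t : ℕ) (i : Fin (P.N (t + 1))) (x : Vec (P.n t)) :
    IsClosed (P.feas t i x) := by
  have hΦ : ∀ j, IsClosed (P.Xbar (t + 1) ∩ P.Phi (t + 1) i j ⁻¹' Set.Iic (P.Q t i x j)) := by
    intro j
    obtain ⟨v, hv, he⟩ := lowerSemicontinuousOn_iff_preimage_Iic.1 (P.Phi_closed (t + 1) i j)
      (P.Q t i x j)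
    rw [he]
    exact (P.Xbar_closed _).inter hv
  have hA : IsClosed {y | P.A (t + 1) i y = P.B t i x + P.b (t + 1) i} :=
    isClosed_eq (P.A (t + 1) i).continuous_of_finiteDimensional continuous_const
  have h : P.feas t i x = (P.Xbar (t + 1) ∩ {y | P.A (t + 1) i y = P.B t i x + P.b (t + 1) i}) ∩
      ⋂ j, (P.Xbar (t + 1) ∩ P.Phi (t + 1) i j ⁻¹' Set.Iic (P.Q t i x j)) := by
    ext y
    simp only [feas, Set.mem_ofPred_eq, Set.mem_inter_iff, Set.mem_iInter, Set.mem_preimage,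
      Set.mem_Iic]
    exact ⟨fun h => ⟨⟨h.1, h.2.1⟩, fun j => ⟨h.1, h.2.2 j⟩⟩,
      fun h => ⟨h.1.1, h.1.2, fun j => (h.2 j).2⟩⟩
  rw [h]
  exact ((P.Xbar_closed _).inter hA).inter (isClosed_iInter hΦ)

theorem isCompact_feas {D : ℕ → ℝ} (hD : P.DiameterBound D) {t : ℕ} (ht : t < P.T)
    {x : Vec (P.n t)} (hx : x ∈ P.region t) (i : Fin (P.N (t + 1))) :
    IsCompact (P.feas t i x) := by
  refine Metric.isCompact_of_isClosed_isBounded (isClosed_feas t i x) ?_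
  refine Metric.isBounded_iff.2 ⟨D (t + 1), fun y hy z hz => ?_⟩
  rw [dist_eq_norm]
  exact (hD (t + 1) (by omega) ht).2 y (feas_subset_region hx hy) z (feas_subset_region hx hz)

theorem State.lowerSemicontinuous_Flow {s : P.State} {t : ℕ} (hs : IsLipschitzConvex (s.model t))
    (i : Fin (P.N t)) : LowerSemicontinuous (s.Flow t i) := by
  obtain ⟨g, hg, -, L, hL, hgl⟩ := hs
  have hgc : Continuous g := by
    refine (LipschitzWith.of_le_add_mul ⟨L, hL⟩ fun x y => ?_).continuous
    rw [dist_eq_norm]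
    exact hgl x y
  have he : s.Flow t i = fun x => P.H t i x + ((P.lam * g x : ℝ) : EReal) := by
    funext x
    rw [State.Flow, hg, EReal.coe_mul]
  rw [he]
  refine (P.H_closedConvex t i).lowerSemicontinuous.add' ?_ fun x =>
    EReal.continuousAt_add (Or.inr (EReal.coe_ne_bot _)) (Or.inr (EReal.coe_ne_top _))
  exact (continuous_coe_real_ereal.comp (continuous_const.mul hgc)).lowerSemicontinuous

theorem State.exists_minimizer {D : ℕ → ℝ} (hD : P.DiameterBound D) (hreg : P.Regular)
    {s : P.State} {t : ℕ} (ht : t < P.T)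
    (hs : IsLipschitzConvex (s.model (t + 1)) ∨ ∀ x, s.model (t + 1) x = ⊥)
    {x : Vec (P.n t)} (hx : x ∈ P.region t) (i : Fin (P.N (t + 1))) :
    ∃ y ∈ P.feas t i x, ∀ u ∈ P.feas t i x, s.Flow (t + 1) i y ≤ s.Flow (t + 1) i u := by
  have hne := hreg.feas_nonempty ht hx i
  rcases hs with hs | hs
  · exact LowerSemicontinuousOn.exists_isMinOn hne (isCompact_feas hD ht hx i)
      ((State.lowerSemicontinuous_Flow hs i).lowerSemicontinuousOn _)
  -- With the initial model the objective is identically `⊥`, so any feasible point is a minimizer.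
  · obtain ⟨y, hy⟩ := hne
    refine ⟨y, hy, fun u _ => ?_⟩
    simp [State.Flow, hs, EReal.coe_mul_bot_of_pos P.lam_pos]

theorem exists_isForward {D : ℕ → ℝ} (hD : P.DiameterBound D) (hreg : P.Regular) {s : P.State}
    (hs : ∀ t, 1 ≤ t → t ≤ P.T → IsLipschitzConvex (s.model t) ∨ ∀ x, s.model t x = ⊥) :
    ∃ w, IsForward s w := by
  -- The hypotheses on `t` and `x` sit inside the existential, so that the choice functions are
  -- total and can be iterated by recursion.
  have step : ∀ t (x : Vec (P.n t)), ∃ (c : Fin (P.N (t + 1)) → Vec (P.n (t + 1)))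
      (x' : Vec (P.n (t + 1))), t < P.T → x ∈ P.region t →
        (∀ i, c i ∈ P.feas t i x ∧
          ∀ y ∈ P.feas t i x, s.Flow (t + 1) i (c i) ≤ s.Flow (t + 1) i y) ∧
        ∃ i, x' = c i ∧ ∀ j, s.gap (t + 1) (c j) ≤ s.gap (t + 1) x' := by
    intro t x
    by_cases h : t < P.T ∧ x ∈ P.region t
    swap
    · exact ⟨0, 0, fun h1 h2 => absurd ⟨h1, h2⟩ h⟩
    choose c hc hmin using
      fun i => State.exists_minimizer hD hreg h.1 (hs (t + 1) (by omega) h.1) h.2 i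
    have : Nonempty (Fin (P.N (t + 1))) := ⟨⟨0, P.N_pos _⟩⟩
    obtain ⟨i, hi⟩ := Finite.exists_max fun i => s.gap (t + 1) (c i)
    exact ⟨c, c i, fun _ _ => ⟨fun i => ⟨hc i, hmin i⟩, i, rfl, hi⟩⟩
  choose c nx hstep using step
  let X : ∀ t, Vec (P.n t) := fun t => Nat.rec (motive := fun t => Vec (P.n t)) 0 nx t
  have hX : ∀ t, t ≤ P.T → X t ∈ P.region t := by
    intro t
    induction t with
    | zero => exact fun _ => rfl
    | succ t ih =>
      intro ht
      obtain ⟨hc, i, hi, -⟩ := hstep t (X t) ht (ih (by omega))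
      change nx t (X t) ∈ _
      rw [hi]
      exact feas_subset_region (ih (by omega)) (hc i).1
  refine ⟨⟨fun t => match t with
    | 0 => fun _ => 0
    | t + 1 => c t (X t), X⟩, rfl, fun t ht => hstep t (X t) ht (hX t ht.le)⟩

/-- Compactness gives a minimizer and regularity makes its value real. Duality is applied on the
part of `Xbar` where `H` is finite; elsewhere the Lagrangian is `⊤` and does not affect the infimum.
-/
theorem exists_isValueWithMultipliers {D : ℕ → ℝ} (hD : P.DiameterBound D) (hreg : P.Regular)
    (hsl : P.Slater) {s : P.State} {t : ℕ} (h1 : 1 ≤ t) (ht : t < P.T)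
    (hs : IsLipschitzConvex (s.model (t + 1))) {x : Vec (P.n t)} (hx : x ∈ P.region t)
    (i : Fin (P.N (t + 1))) :
    ∃ v y z, IsValueWithMultipliers t i x (s.Flow (t + 1) i) v y z := by
  obtain ⟨us, hus, hmin⟩ := State.exists_minimizer hD hreg ht (Or.inl hs) hx i
  obtain ⟨u₀, hu₀, hA, hΦ⟩ := hsl t h1 ht x hx i
  obtain ⟨g, hg, hgc, -⟩ := hs
  have hcl := P.H_closedConvex (t + 1) i
  let f : Vec (P.n (t + 1)) → ℝ := fun u => (P.H (t + 1) i u).toReal + P.lam * g u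
  have hflow : ∀ u, P.H (t + 1) i u < ⊤ → s.Flow (t + 1) i u = f u := by
    intro u hu
    rw [State.Flow, hg, ← EReal.coe_mul, ← hcl.coe_toReal hu, ← EReal.coe_add]
  have hconv : Convex ℝ (P.Xbar (t + 1) ∩ {u | P.H (t + 1) i u < ⊤}) :=
    (P.Xbar_convex _).inter hcl.convex_dom
  have hf : ConvexOn ℝ (P.Xbar (t + 1) ∩ {u | P.H (t + 1) i u < ⊤}) f :=
    (hcl.convexOn_toReal.subset Set.inter_subset_right hconv).add
      ((hgc.subset (Set.subset_univ _) hconv).smul P.lam_pos.le)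
  have hus' := hreg.H_lt_top (by omega) ht (feas_subset_region hx hus) i
  obtain ⟨y, z, hz, hdual⟩ := exists_lagrange_multipliers hf (P.A (t + 1) i)
    (P.B t i x + P.b (t + 1) i) (φ := P.Phi (t + 1) i)
    (fun j => (P.Phi_convex (t + 1) i j).subset Set.inter_subset_left hconv) (P.Q t i x) hu₀ hA hΦ
    (v := f us) fun u hu hAu hΦu => by
      have := hmin u ⟨hu.1, hAu, hΦu⟩
      rwa [hflow us hus', hflow u hu.2, EReal.coe_le_coe_iff] at this
  refine ⟨f us, y, z, le_antisymm ?_ ?_, hz, le_antisymm ?_ ?_⟩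
  · exact (iInf₂_le us hus).trans_eq (hflow us hus')
  · exact le_iInf₂ fun u hu => (hflow us hus').symm.trans_le (hmin u hu)
  · refine (iInf₂_le us hus.1).trans ?_
    rw [hflow us hus', ← EReal.coe_add, EReal.coe_le_coe_iff]
    have e1 : ∑ j, y j * (P.B t i x j + P.b (t + 1) i j - P.A (t + 1) i us j) = 0 :=
      Finset.sum_eq_zero fun j _ => by rw [hus.2.1]; simp
    have e2 : ∑ j, z j * (P.Phi (t + 1) i j us - P.Q t i x j) ≤ 0 :=
      Finset.sum_nonpos fun j _ => mul_nonpos_of_nonneg_of_nonpos (hz j)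
        (sub_nonpos.2 (hus.2.2 j))
    linarith
  · refine le_iInf₂ fun u hu => ?_
    by_cases hH : P.H (t + 1) i u < ⊤
    · rw [hflow u hH, ← EReal.coe_add, EReal.coe_le_coe_iff]
      exact hdual u ⟨hu, hH⟩
    · rw [State.Flow, not_lt_top_iff.1 hH, hg, ← EReal.coe_mul, EReal.top_add_coe,
        EReal.top_add_coe]
      exact le_top

theorem exists_isBackward {D : ℕ → ℝ} (hD : P.DiameterBound D) (hreg : P.Regular)
    (hsl : P.Slater) (δ : ℕ → ℝ) {s : P.State} {w : P.ForwardPass}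
    (hlast : IsLipschitzConvex (s.model P.T))
    (hs : ∀ t, 1 ≤ t → t ≤ P.T → IsLipschitzConvex (s.model t) ∨ ∀ x, s.model t x = ⊥)
    (hw : IsForward s w) : ∃ s', IsBackward δ s w s' := by
  classical
  let sat' : ∀ t, Set (Vec (P.n t)) := fun t =>
    if s.gap (t + 1) (w.x (t + 1)) ≤ ENNReal.ofReal (δ (t + 1)) then insert (w.x t) (s.sat t)
    else s.sat t
  let IsCut (m : ∀ t, Vec (P.n t) → EReal) (t : ℕ) : Prop :=
    ∃ (v : Fin (P.N (t + 1)) → ℝ) (y : Fin (P.N (t + 1)) → Vec (P.m (t + 1)))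
        (z : Fin (P.N (t + 1)) → Vec (P.p (t + 1))),
      (∀ i, IsValueWithMultipliers t i (w.x t) (State.Flow ⟨m, sat'⟩ (t + 1) i) (v i) (y i) (z i)) ∧
      ∀ e, m t e = max (s.model t e)
        (((P.N (t + 1) : ℝ)⁻¹ * ∑ i, cut t i (w.x t) (v i) (y i) (z i) e : ℝ) : EReal)
  -- The models are built from stage `T` downwards: changing stage `r` leaves the subproblems of
  -- later stages intact. Convexity and the Lipschitz property of `m r` are carried along because
  -- they provide the multipliers one stage earlier.
  have key : ∀ r, r ≤ P.T → 1 ≤ r → ∃ m : ∀ t, Vec (P.n t) → EReal, m P.T = s.model P.T ∧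
      (∀ t, r ≤ t → t < P.T → IsCut m t) ∧ IsLipschitzConvex (m r) := by
    intro r hr
    induction hr using Nat.decreasingInduction with
    | self => exact fun _ => ⟨s.model, rfl, fun t h h' => absurd h (not_le.2 h'), hlast⟩
    | of_succ r hr ih =>
      intro h1
      obtain ⟨m, hmT, hmcut, hmr⟩ := ih (by omega)
      choose v y z hval using fun i => exists_isValueWithMultipliers (s := ⟨m, sat'⟩) hD hreg hsl
        h1 hr hmr (hw.x_mem_region hr.le) i
      let new : Vec (P.n r) → EReal := fun e => max (s.model r e)
        (((P.N (r + 1) : ℝ)⁻¹ * ∑ i, cut r i (w.x r) (v i) (y i) (z i) e : ℝ) : EReal)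
      have hflow : ∀ t, r < t → ∀ i, State.Flow (P := P) ⟨Function.update m r new, sat'⟩ t i =
          State.Flow ⟨m, sat'⟩ t i := by
        intro t ht i
        funext u
        simp only [State.Flow]
        rw [Function.update_of_ne (by omega)]
      refine ⟨Function.update m r new, ?_, fun t hrt htT => ?_, ?_⟩
      · rw [Function.update_of_ne (by omega), hmT]
      · rcases hrt.eq_or_lt with rfl | hrt
        · refine ⟨v, y, z, fun i => ?_, fun e => ?_⟩
          · rw [hflow _ (by omega)]
            exact hval i
          · rw [Function.update_self]
        · obtain ⟨v', y', z', hval', hm'⟩ := hmcut t hrt htT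
          refine ⟨v', y', z', fun i => ?_, fun e => ?_⟩
          · rw [hflow _ (by omega)]
            exact hval' i
          · rw [Function.update_of_ne (by omega), hm']
      · rw [Function.update_self]
        have hc := isLipschitzConvex_average_cut r (w.x r) v y z
        rcases hs r h1 hr.le with h | h
        · exact h.sup hc
        · simpa [new, h] using hc
  obtain ⟨m, hmT, hmcut, -⟩ := key 1 P.one_le_T le_rfl
  exact ⟨⟨m, sat'⟩, hmT, fun t h1 ht => ⟨hmcut t h1 ht, fun h => if_pos h, fun h => if_neg h⟩⟩

theorem IsExecution.exists_continuation {D δ : ℕ → ℝ} {K : ℕ} {s : ℕ → P.State}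
    {w : ℕ → P.ForwardPass} (h : P.IsExecution δ K s w) (hD : P.DiameterBound D)
    (hreg : P.Regular) (hsl : P.Slater) (hns : ¬ P.StoppedAt δ K s w) :
    ∃ (s' : ℕ → P.State) (w' : ℕ → P.ForwardPass), P.IsExecution δ (K + 1) s' w' ∧
      ∀ k, k ≤ K → s' k = s k ∧ w' k = w k := by
  classical
  have hmodel : ∀ t, 1 ≤ t → t ≤ P.T →
      IsLipschitzConvex ((s K).model t) ∨ ∀ x, (s K).model t x = ⊥ :=
    fun t h1 hT => (h.model_cases le_rfl h1 hT).imp id fun h' => h'.2.2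
  obtain ⟨wn, hwn⟩ := exists_isForward hD hreg hmodel
  obtain ⟨sb, hsb⟩ := exists_isBackward hD hreg hsl δ
    (isLipschitzConvex_zero (h.model_last le_rfl)) hmodel hwn
  let sn : P.State := if Stops δ (s K) wn then s K else sb
  have hs' : ∀ k, k ≤ K → Function.update s (K + 1) sn k = s k := fun k hk =>
    Function.update_of_ne (by omega) _ _
  have hw' : ∀ k, k ≤ K → Function.update w (K + 1) wn k = w k := fun k hk =>
    Function.update_of_ne (by omega) _ _
  refine ⟨Function.update s (K + 1) sn, Function.update w (K + 1) wn, ⟨?_, fun k hk => ?_,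
    fun k hk => ?_⟩, fun k hk => ⟨hs' k hk, hw' k hk⟩⟩
  · rw [hs' 0 (Nat.zero_le _), h.1]
  · rw [hs' k (by omega)]
    rcases (Nat.lt_succ_iff.1 hk).lt_or_eq with hk | rfl
    · rw [hs' (k + 1) hk, hw' (k + 1) hk]
      exact h.2.1 k hk
    · rw [Function.update_self, Function.update_self]
      exact ⟨hwn, fun hst => if_pos hst, fun hst => by rwa [show sn = sb from if_neg hst]⟩
  · rw [hs' k (by omega), hw' (k + 1) (by omega)]
    exact h.not_stops hns (by omega)

end SAAProblem

/-! ### Assembly of the main theorem -/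

theorem mainTheorem2 (P : SAAProblem) (D M δ : ℕ → ℝ)
    (hD : P.DiameterBound D) (hreg : P.Regular) (hM : P.LipschitzBound M)
    (hδ : ∀ t, 1 ≤ t → t ≤ P.T → 0 ≤ δ t) :
    -- under Slater's condition the method can always be continued until its test succeeds
    (P.Slater → ∀ (K : ℕ) (s : ℕ → P.State) (w : ℕ → P.ForwardPass),
      P.IsExecution δ K s w → ¬ P.StoppedAt δ K s w →
      ∃ (s' : ℕ → P.State) (w' : ℕ → P.ForwardPass), P.IsExecution δ (K + 1) s' w' ∧
        ∀ k, k ≤ K → s' k = s k ∧ w' k = w k) ∧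
    ∀ (K : ℕ) (s : ℕ → P.State) (w : ℕ → P.ForwardPass), P.IsExecution δ K s w →
      -- the models have Lipschitz constants
      (∃ Mlow : ℕ → ℝ, P.ModelLipschitzBound K s Mlow) ∧
      -- the iteration bound
      (K : ENNReal) ≤ P.iterBound D δ + 1 ∧
      (¬ P.StoppedAt δ K s w → (K : ENNReal) ≤ P.iterBound D δ) ∧
      -- the accuracy at termination
      (∀ Mlow : ℕ → ℝ, P.ModelLipschitzBound K s Mlow → P.StoppedAt δ K s w →
        P.IsApproxSol ((w K).x 1) (P.eps M Mlow δ 0)) ∧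
      -- uniform parameters
      ∀ (n : ℕ) (Dmax Mmax ε : ℝ) (Mlow : ℕ → ℝ), P.ModelLipschitzBound K s Mlow →
        (∀ t, 1 ≤ t → t ≤ P.T →
          P.n t ≤ n ∧ D t ≤ Dmax ∧ max (M t) (Mlow t) ≤ Mmax ∧ δ t = ε) →
        (K : ENNReal) ≤ P.uniformIterBound n Dmax ε + 1 ∧
        (¬ P.StoppedAt δ K s w → (K : ENNReal) ≤ P.uniformIterBound n Dmax ε) ∧
        (P.StoppedAt δ K s w →
          P.IsApproxSol ((w K).x 1) (2 * Mmax * P.horizonFactor * ε)) := by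
  refine ⟨fun hsl K s w h hns => h.exists_continuation hD hreg hsl hns, fun K s w h =>
    ⟨h.exists_modelLipschitzBound hD hreg, h.le_iterBound_add_one hD hδ, h.le_iterBound hD hδ,
      fun Mlow hMlow => h.isApproxSol hreg hM hMlow hδ,
      fun n Dmax Mmax ε Mlow hMlow hu => ?_⟩⟩
  have hbound := SAAProblem.iterBound_le_uniformIterBound (P := P) (D := D) (δ := δ)
    fun t h1 hT => ⟨(hu t h1 hT).1, (hu t h1 hT).2.1, (hu t h1 hT).2.2.2⟩
  refine ⟨(h.le_iterBound_add_one hD hδ).trans (add_le_add hbound le_rfl),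
    fun hns => (h.le_iterBound hD hδ hns).trans hbound,
    fun hstopped => (h.isApproxSol hreg hM hMlow hδ hstopped).mono ?_⟩
  obtain ⟨-, -, hm, hd⟩ := hu 1 le_rfl P.one_le_T
  exact SAAProblem.eps_zero_le
    ((hM 1 le_rfl P.one_le_T).1.trans ((le_max_left _ _).trans hm))
    (hd ▸ hδ 1 le_rfl P.one_le_T) fun t h1 hT => (hu t h1 hT).2.2
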